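/- Let $m \ge 0$ and $n \ge 1$ be integers, and let $\mathbb{H}^n$ be the Heisenberg group: $\mathbb{R}^{2n+1}$ with coordinates $(x_1,y_1,\dots,x_n,y_n,t)$, the horizontal distribution spanned by $$X_j = \frac{\partial}{\partial x_j} + 2y_j\frac{\partial}{\partial t}, \qquad Y_j = \frac{\partial}{\partial y_j} - 2x_j\frac{\partial}{\partial t}, \qquad j=1,\dots,n,$$ and the Carnot–Carathéodory metric $d$, where $d(p,q)$ is the infimum of the lengths $\int_a^b \big(\sum_{j} x_j'(s)^2 + y_j'(s)^2\big)^{1/2}\,ds$ over all horizontal curves $\gamma:[a,b]\to\mathbb{R}^{2n+1}$ from $p$ to $q$ (absolutely continuous curves with $\gamma'(s)\in \mathrm{span}\{X_j(\gamma(s)),Y_j(\gamma(s))\}$ for a.e. $s$). Let $\Omega\subset\mathbb{R}^m$ be open, connected and bounded, and let $1\le p<\infty$. $W^{1,p}(\Omega)$ consists of the real-valued functions in $L^p(\Omega)$ whose distributional partial derivatives are functions in $L^p(\Omega)$. * $W^{1,p}(\Omega,\mathbb{H}^n)$ is the class of maps $F=(f_1,g_1,\dots,f_n,g_n,h):\Omega\to\mathbb{H}^n$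 all of whose components are in $W^{1,p}(\Omega)$ and which satisfy the weak contact equation $$\nabla h(x) = 2\sum_{j=1}^n \big(g_j(x)\nabla f_j(x) - f_j(x)\nabla g_j(x)\big)\quad\text{for a.e. } x\in\Omega .$$ * For a metric space $Y$, $AR^{1,p}(\Omega,Y)$ is the class of maps $F:\Omega\to Y$ for which there is a non-negative $g\in L^p(\Omega)$ such that for every $K \ge 0$ and every $K$-Lipschitz $\phi:Y\to\mathbb{R}$ we have $\phi\circ F\in W^{1,p}(\Omega)$ and $|\partial(\phi\circ F)/\partial x_k(x)|\le K g(x)$ for $k=1,\dots,m$ and a.e. $x\in\Omega$. Then $$W^{1,p}(\Omega,\mathbb{H}^n)\subset AR^{1,p}(\Omega,\mathbb{H}^n),$$ where $\mathbb{H}^n$ carries the metric $d$. Conversely, if $F\in AR^{1,p}(\Omega,\mathbb{H}^n)$ is bounded, then $F\in W^{1,p}(\Omega,\mathbb{H}^n)$. -/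

import Mathlib

open MeasureTheory Set
open scoped ENNReal NNReal ContDiff

/-! ## Scalar Sobolev functions -/

/-- `v` is the weak (distributional) partial derivative `∂u/∂x_k` on the open set `Ω ⊆ ℝ^m`:
`u` and `v` are locally integrable on `Ω` and `∫_Ω u ∂_k φ = - ∫_Ω v φ` for all
`φ ∈ C_c^∞(Ω)`. -/
def IsWeakPartial {m : ℕ} (Ω : Set (EuclideanSpace ℝ (Fin m))) (k : Fin m)
    (u v : EuclideanSpace ℝ (Fin m) → ℝ) : Prop :=
  LocallyIntegrableOn u Ω volume ∧ LocallyIntegrableOn v Ω volume ∧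
    ∀ φ : EuclideanSpace ℝ (Fin m) → ℝ,
      ContDiff ℝ ∞ φ → HasCompactSupport φ → tsupport φ ⊆ Ω →
        ∫ x in Ω, u x * fderiv ℝ φ x (EuclideanSpace.single k 1) = - ∫ x in Ω, v x * φ x

/-- The real-valued functions of class `W^{1,p}(Ω)`: functions in `L^p(Ω)` whose distributional
partial derivatives are also functions in `L^p(Ω)`. Only the values on `Ω` matter. -/
def SobolevReal {m : ℕ} (p : ℝ≥0∞) (Ω : Set (EuclideanSpace ℝ (Fin m))) :
    Set (EuclideanSpace ℝ (Fin m) → ℝ) :=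
  {u | MemLp u p (volume.restrict Ω) ∧
    ∀ k : Fin m, ∃ v : EuclideanSpace ℝ (Fin m) → ℝ,
      MemLp v p (volume.restrict Ω) ∧ IsWeakPartial Ω k u v}

/-! ## The Ambrosio-Reshetnyak-Sobolev class -/

/-- The class `AR^{1,p}(Ω, Y)` of maps into a space `Y` with a distance: there is one non-negative
`g ∈ L^p(Ω)` such that for every `K`-Lipschitz `φ : Y → ℝ`, the function `φ ∘ F` is in
`W^{1,p}(Ω)`, with weak partial derivatives bounded by `K g` almost everywhere in `Ω`.
(The weak partial derivative is unique up to null sets.) -/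
def ARSobolev {m : ℕ} {Y : Type*} [PseudoEMetricSpace Y] (p : ℝ≥0∞)
    (Ω : Set (EuclideanSpace ℝ (Fin m))) : Set (EuclideanSpace ℝ (Fin m) → Y) :=
  {F | ∃ g : EuclideanSpace ℝ (Fin m) → ℝ,
    (∀ x ∈ Ω, 0 ≤ g x) ∧ MemLp g p (volume.restrict Ω) ∧
    ∀ (K : ℝ≥0) (φ : Y → ℝ), LipschitzWith K φ →
      (fun x => φ (F x)) ∈ SobolevReal p Ω ∧
      ∀ k : Fin m, ∃ v : EuclideanSpace ℝ (Fin m) → ℝ,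
        IsWeakPartial Ω k (fun x => φ (F x)) v ∧
        ∀ᵐ x ∂(volume.restrict Ω), |v x| ≤ K * g x}

/-! ## The Heisenberg group with its Carnot-Carathéodory distance -/

/-- The points of the Heisenberg group `ℍ^n = ℝ^{2n+1}`, written in the coordinates
`(x_1, y_1, …, x_n, y_n, t)`. -/
@[ext]
structure Heis (n : ℕ) where
  /-- the coordinates `x_1, …, x_n` -/
  x : Fin n → ℝ
  /-- the coordinates `y_1, …, y_n` -/
  y : Fin n → ℝ
  /-- the last coordinate -/
  t : ℝ

namespace Heis

variable {n : ℕ}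

/-- The group law of `ℍ^n`. -/
instance : Mul (Heis n) where
  mul p q := ⟨fun j => p.x j + q.x j, fun j => p.y j + q.y j,
    p.t + q.t + 2 * ∑ j, (q.x j * p.y j - p.x j * q.y j)⟩

/-- `γ` is a horizontal curve on `[a, b]`: it is absolutely continuous (as a curve in `ℝ^{2n+1}`)
and for almost every `s` the velocity `γ'(s)` lies in the span of the left invariant fields
`X_j = ∂/∂x_j + 2 y_j ∂/∂t` and `Y_j = ∂/∂y_j - 2 x_j ∂/∂t` at `γ(s)`, i.e.
`γ'(s) = ∑ x_j'(s) X_j + y_j'(s) Y_j`. -/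
structure IsHorizontal (γ : ℝ → Heis n) (a b : ℝ) : Prop where
  ac_x : ∀ j, AbsolutelyContinuousOnInterval (fun s => (γ s).x j) a b
  ac_y : ∀ j, AbsolutelyContinuousOnInterval (fun s => (γ s).y j) a b
  ac_t : AbsolutelyContinuousOnInterval (fun s => (γ s).t) a b
  contact : ∀ᵐ s ∂(volume.restrict (Icc a b)),
    deriv (fun r => (γ r).t) s =
      2 * ∑ j, ((γ s).y j * deriv (fun r => (γ r).x j) s
        - (γ s).x j * deriv (fun r => (γ r).y j) s)

/-- The norm `‖γ'(s)‖_H` of a horizontal velocity, for the metric in which the `X_j` and `Y_j`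
are orthonormal. -/
noncomputable def speed (γ : ℝ → Heis n) (s : ℝ) : ℝ :=
  Real.sqrt (∑ j, (deriv (fun r => (γ r).x j) s ^ 2 + deriv (fun r => (γ r).y j) s ^ 2))

/-- The length `ℓ_H(γ)` of a horizontal curve on `[a, b]`. -/
noncomputable def length (γ : ℝ → Heis n) (a b : ℝ) : ℝ≥0∞ :=
  ∫⁻ s in Icc a b, ENNReal.ofReal (speed γ s)

/-- The Carnot-Carathéodory distance: the infimum of the lengths of the horizontal curves
from `p` to `q`. -/
noncomputable def ccDist (p q : Heis n) : ℝ≥0∞ :=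
  ⨅ (γ : ℝ → Heis n) (a : ℝ) (b : ℝ) (_ : a ≤ b ∧ IsHorizontal γ a b ∧ γ a = p ∧ γ b = q),
    length γ a b

/-! ### The Carnot-Carathéodory distance is symmetric and satisfies the triangle inequality -/

theorem ac_congr {f g : ℝ → ℝ} {a b : ℝ} (hf : AbsolutelyContinuousOnInterval f a b)
    (h : ∀ s ∈ uIcc a b, g s = f s) : AbsolutelyContinuousOnInterval g a b := by
  rw [absolutelyContinuousOnInterval_iff] at hf ⊢
  intro ε hε
  obtain ⟨δ, hδ, H⟩ := hf ε hε
  refine ⟨δ, hδ, fun E hE hs => ?_⟩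
  have := H E hE hs
  refine lt_of_le_of_lt (le_of_eq (Finset.sum_congr rfl fun i hi => ?_)) this
  rw [h _ (hE.1 i hi).1, h _ (hE.1 i hi).2]

theorem ac_of_integral {f v : ℝ → ℝ} {a b : ℝ} (hv : IntervalIntegrable v volume a b)
    (h : ∀ s ∈ uIcc a b, f s = f a + ∫ r in a..s, v r) :
    AbsolutelyContinuousOnInterval f a b := by
  refine ac_congr (f := fun s => f a + ∫ r in a..s, v r) ?_ h
  have h1 : AbsolutelyContinuousOnInterval (fun _ : ℝ => f a) a b :=
    (LipschitzWith.const (f a)).lipschitzOnWith.absolutelyContinuousOnInterval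
  exact h1.fun_add (hv.absolutelyContinuousOnInterval_intervalIntegral left_mem_uIcc)

theorem ac_integral {f : ℝ → ℝ} {a b s : ℝ} (hf : AbsolutelyContinuousOnInterval f a b)
    (hs : s ∈ uIcc a b) : f s = f a + ∫ r in a..s, deriv f r := by
  rw [(hf.mono (uIcc_subset_uIcc_left hs)).integral_deriv_eq_sub]
  ring

theorem ac_trans {f : ℝ → ℝ} {a b c : ℝ} (hab : a ≤ b) (hbc : b ≤ c)
    (h1 : AbsolutelyContinuousOnInterval f a b) (h2 : AbsolutelyContinuousOnInterval f b c) :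
    AbsolutelyContinuousOnInterval f a c := by
  have i1 := h1.intervalIntegrable_deriv
  have i2 := h2.intervalIntegrable_deriv
  refine ac_of_integral (i1.trans i2) fun s hs => ?_
  rw [uIcc_of_le (hab.trans hbc)] at hs
  rcases le_total s b with h | h
  · exact ac_integral h1 (by rw [uIcc_of_le hab]; exact ⟨hs.1, h⟩)
  · have hs' : s ∈ uIcc b c := by rw [uIcc_of_le hbc]; exact ⟨h, hs.2⟩
    rw [← intervalIntegral.integral_add_adjacent_intervals i1
      (i2.mono_set (uIcc_subset_uIcc_left hs')), ac_integral h2 hs',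
      ac_integral h1 right_mem_uIcc]
    ring

theorem ac_shift {f : ℝ → ℝ} {a b : ℝ} (c : ℝ) (h : AbsolutelyContinuousOnInterval f a b) :
    AbsolutelyContinuousOnInterval (fun s => f (s + c)) (a - c) (b - c) := by
  have hi := h.intervalIntegrable_deriv.comp_add_right c
  refine ac_of_integral hi fun s hs => ?_
  have hs' : s + c ∈ uIcc a b := by
    rw [mem_uIcc] at hs ⊢
    rcases hs with hs | hs
    · left; constructor <;> linarith
    · right; constructor <;> linarith
  simp only [intervalIntegral.integral_comp_add_right, sub_add_cancel]
  exact ac_integral h hs'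

theorem ac_neg_arg {f : ℝ → ℝ} {a b : ℝ} (h : AbsolutelyContinuousOnInterval f a b) :
    AbsolutelyContinuousOnInterval (fun s => f (-s)) (-b) (-a) := by
  have hi : IntervalIntegrable (fun s => -deriv f (-s)) volume (-b) (-a) := by
    exact ((IntervalIntegrable.iff_comp_neg).1 h.intervalIntegrable_deriv).symm.neg
  refine ac_of_integral hi fun s hs => ?_
  have hs' : -s ∈ uIcc b a := by
    rw [mem_uIcc] at hs ⊢
    rcases hs with hs | hs
    · right; constructor <;> linarith
    · left; constructor <;> linarith
  rw [intervalIntegral.integral_neg, intervalIntegral.integral_comp_neg, neg_neg,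
    ac_integral h.symm hs', intervalIntegral.integral_symm (-s) b]

theorem IsHorizontal.shift {γ : ℝ → Heis n} {a b : ℝ} (c : ℝ) (h : IsHorizontal γ a b) :
    IsHorizontal (fun s => γ (s + c)) (a - c) (b - c) where
  ac_x j := ac_shift (f := fun s => (γ s).x j) c (h.ac_x j)
  ac_y j := ac_shift (f := fun s => (γ s).y j) c (h.ac_y j)
  ac_t := ac_shift (f := fun s => (γ s).t) c h.ac_t
  contact := by
    have h0 := (ae_restrict_iff' measurableSet_Icc).1 h.contact
    have h1 := (measurePreserving_add_right volume c).quasiMeasurePreserving.ae h0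
    refine (ae_restrict_iff' measurableSet_Icc).2 ?_
    filter_upwards [h1] with s hs hm
    have := hs ⟨by linarith [hm.1], by linarith [hm.2]⟩
    have ex : ∀ j, deriv (fun r => (γ (r + c)).x j) s = deriv (fun r => (γ r).x j) (s + c) :=
      fun j => deriv_comp_add_const (fun r => (γ r).x j) c s
    have ey : ∀ j, deriv (fun r => (γ (r + c)).y j) s = deriv (fun r => (γ r).y j) (s + c) :=
      fun j => deriv_comp_add_const (fun r => (γ r).y j) c s
    have et : deriv (fun r => (γ (r + c)).t) s = deriv (fun r => (γ r).t) (s + c) :=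
      deriv_comp_add_const (fun r => (γ r).t) c s
    rw [et, this]
    simp only [ex, ey]

theorem length_shift (γ : ℝ → Heis n) (a b c : ℝ) :
    length (fun s => γ (s + c)) (a - c) (b - c) = length γ a b := by
  unfold length
  have hp : Icc (a - c) (b - c) = (fun s => s + c) ⁻¹' Icc a b := by
    simp
  rw [hp, ← (measurePreserving_add_right volume c).setLIntegral_comp_preimage_emb
    (measurableEmbedding_addRight c) (fun s => ENNReal.ofReal (speed γ s)) (Icc a b)]
  refine lintegral_congr fun s => ?_
  have ex : ∀ j, deriv (fun r => (γ (r + c)).x j) s = deriv (fun r => (γ r).x j) (s + c) :=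
    fun j => deriv_comp_add_const (fun r => (γ r).x j) c s
  have ey : ∀ j, deriv (fun r => (γ (r + c)).y j) s = deriv (fun r => (γ r).y j) (s + c) :=
    fun j => deriv_comp_add_const (fun r => (γ r).y j) c s
  simp only [speed, ex, ey]

theorem IsHorizontal.reverse {γ : ℝ → Heis n} {a b : ℝ} (h : IsHorizontal γ a b) :
    IsHorizontal (fun s => γ (-s)) (-b) (-a) where
  ac_x j := ac_neg_arg (f := fun s => (γ s).x j) (h.ac_x j)
  ac_y j := ac_neg_arg (f := fun s => (γ s).y j) (h.ac_y j)
  ac_t := ac_neg_arg (f := fun s => (γ s).t) h.ac_t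
  contact := by
    have h0 := (ae_restrict_iff' measurableSet_Icc).1 h.contact
    have h1 := (Measure.measurePreserving_neg (volume : Measure ℝ)).quasiMeasurePreserving.ae h0
    refine (ae_restrict_iff' measurableSet_Icc).2 ?_
    filter_upwards [h1] with s hs hm
    have := hs ⟨by linarith [hm.2], by linarith [hm.1]⟩
    have ex : ∀ j, deriv (fun r => (γ (-r)).x j) s = -deriv (fun r => (γ r).x j) (-s) :=
      fun j => deriv_comp_neg (fun r => (γ r).x j) s
    have ey : ∀ j, deriv (fun r => (γ (-r)).y j) s = -deriv (fun r => (γ r).y j) (-s) :=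
      fun j => deriv_comp_neg (fun r => (γ r).y j) s
    have et : deriv (fun r => (γ (-r)).t) s = -deriv (fun r => (γ r).t) (-s) :=
      deriv_comp_neg (fun r => (γ r).t) s
    rw [et, this]
    simp only [ex, ey]
    rw [← mul_neg, ← Finset.sum_neg_distrib]
    congr 1
    exact Finset.sum_congr rfl fun j _ => by ring

theorem length_reverse (γ : ℝ → Heis n) (a b : ℝ) :
    length (fun s => γ (-s)) (-b) (-a) = length γ a b := by
  unfold length
  have hp : Icc (-b) (-a) = (fun s : ℝ => -s) ⁻¹' Icc a b := by
    ext s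
    simp only [mem_Icc, mem_preimage]
    constructor <;> rintro ⟨h1, h2⟩ <;> constructor <;> linarith
  rw [hp, ← (Measure.measurePreserving_neg (volume : Measure ℝ)).setLIntegral_comp_preimage_emb
    (Homeomorph.neg ℝ).measurableEmbedding (fun s => ENNReal.ofReal (speed γ s)) (Icc a b)]
  refine lintegral_congr fun s => ?_
  have ex : ∀ j, deriv (fun r => (γ (-r)).x j) s = -deriv (fun r => (γ r).x j) (-s) :=
    fun j => deriv_comp_neg (fun r => (γ r).x j) s
  have ey : ∀ j, deriv (fun r => (γ (-r)).y j) s = -deriv (fun r => (γ r).y j) (-s) :=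
    fun j => deriv_comp_neg (fun r => (γ r).y j) s
  simp only [speed, ex, ey, neg_sq]

open scoped Classical in
theorem deriv_glue_left {γ₁ γ₂ : ℝ → Heis n} {b s : ℝ} (f : Heis n → ℝ) (h : s < b) :
    deriv (fun r => f (if r ≤ b then γ₁ r else γ₂ r)) s = deriv (fun r => f (γ₁ r)) s := by
  refine Filter.EventuallyEq.deriv_eq ?_
  filter_upwards [Iio_mem_nhds h] with r hr
  rw [if_pos (le_of_lt hr)]

open scoped Classical in
theorem deriv_glue_right {γ₁ γ₂ : ℝ → Heis n} {b s : ℝ} (f : Heis n → ℝ) (h : b < s) :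
    deriv (fun r => f (if r ≤ b then γ₁ r else γ₂ r)) s = deriv (fun r => f (γ₂ r)) s := by
  refine Filter.EventuallyEq.deriv_eq ?_
  filter_upwards [Ioi_mem_nhds h] with r hr
  rw [if_neg (not_le.2 hr)]

open scoped Classical in
theorem ac_glue {γ₁ γ₂ : ℝ → Heis n} {a b c : ℝ} (f : Heis n → ℝ) (hab : a ≤ b) (hbc : b ≤ c)
    (h : γ₁ b = γ₂ b) (h₁ : AbsolutelyContinuousOnInterval (fun s => f (γ₁ s)) a b)
    (h₂ : AbsolutelyContinuousOnInterval (fun s => f (γ₂ s)) b c) :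
    AbsolutelyContinuousOnInterval (fun s => f (if s ≤ b then γ₁ s else γ₂ s)) a c := by
  refine ac_trans hab hbc (ac_congr h₁ fun s hs => ?_) (ac_congr h₂ fun s hs => ?_)
  · rw [uIcc_of_le hab] at hs
    rw [if_pos hs.2]
  · rw [uIcc_of_le hbc] at hs
    rcases hs.1.eq_or_lt with rfl | h'
    · rw [if_pos le_rfl, h]
    · rw [if_neg (not_le.2 h')]

open scoped Classical in
theorem IsHorizontal.glue {γ₁ γ₂ : ℝ → Heis n} {a b c : ℝ} (hab : a ≤ b) (hbc : b ≤ c)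
    (h : γ₁ b = γ₂ b) (h₁ : IsHorizontal γ₁ a b) (h₂ : IsHorizontal γ₂ b c) :
    IsHorizontal (fun s => if s ≤ b then γ₁ s else γ₂ s) a c where
  ac_x j := ac_glue (fun p => p.x j) hab hbc h (h₁.ac_x j) (h₂.ac_x j)
  ac_y j := ac_glue (fun p => p.y j) hab hbc h (h₁.ac_y j) (h₂.ac_y j)
  ac_t := ac_glue (fun p => p.t) hab hbc h h₁.ac_t h₂.ac_t
  contact := by
    have k₁ := (ae_restrict_iff' measurableSet_Icc).1 h₁.contact
    have k₂ := (ae_restrict_iff' measurableSet_Icc).1 h₂.contact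
    refine (ae_restrict_iff' measurableSet_Icc).2 ?_
    filter_upwards [k₁, k₂, Measure.ae_ne volume b] with s hs₁ hs₂ hne hm
    rcases lt_or_gt_of_ne hne with hl | hr
    · rw [deriv_glue_left (fun p => p.t) hl, hs₁ ⟨hm.1, hl.le⟩, if_pos hl.le]
      congr 1
      refine Finset.sum_congr rfl fun j _ => ?_
      rw [deriv_glue_left (fun p => p.x j) hl, deriv_glue_left (fun p => p.y j) hl]
    · rw [deriv_glue_right (fun p => p.t) hr, hs₂ ⟨hr.le, hm.2⟩, if_neg (not_le.2 hr)]
      congr 1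
      refine Finset.sum_congr rfl fun j _ => ?_
      rw [deriv_glue_right (fun p => p.x j) hr, deriv_glue_right (fun p => p.y j) hr]

open scoped Classical in
theorem length_glue (γ₁ γ₂ : ℝ → Heis n) {a b c : ℝ} (hab : a ≤ b) (hbc : b ≤ c) :
    length (fun s => if s ≤ b then γ₁ s else γ₂ s) a c ≤ length γ₁ a b + length γ₂ b c := by
  unfold length
  rw [← Icc_union_Icc_eq_Icc hab hbc]
  refine (lintegral_union_le _ _ _).trans (add_le_add (le_of_eq ?_) (le_of_eq ?_))
  · refine lintegral_congr_ae ((ae_restrict_iff' measurableSet_Icc).2 ?_)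
    filter_upwards [Measure.ae_ne volume b] with s hne hm
    have hl := lt_of_le_of_ne hm.2 hne
    simp only [speed]
    congr 2
    refine Finset.sum_congr rfl fun j _ => ?_
    rw [deriv_glue_left (fun p => p.x j) hl, deriv_glue_left (fun p => p.y j) hl]
  · refine lintegral_congr_ae ((ae_restrict_iff' measurableSet_Icc).2 ?_)
    filter_upwards [Measure.ae_ne volume b] with s hne hm
    have hr := lt_of_le_of_ne hm.1 hne.symm
    simp only [speed]
    congr 2
    refine Finset.sum_congr rfl fun j _ => ?_
    rw [deriv_glue_right (fun p => p.x j) hr, deriv_glue_right (fun p => p.y j) hr]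

theorem ccDist_le {γ : ℝ → Heis n} {a b : ℝ} (hab : a ≤ b) (h : IsHorizontal γ a b) :
    ccDist (γ a) (γ b) ≤ length γ a b :=
  iInf_le_of_le γ (iInf_le_of_le a (iInf_le_of_le b (iInf_le_of_le ⟨hab, h, rfl, rfl⟩ le_rfl)))

theorem ccDist_self (p : Heis n) : ccDist p p = 0 := by
  have hc : ∀ r : ℝ, AbsolutelyContinuousOnInterval (fun _ : ℝ => r) 0 0 := fun r =>
    (LipschitzWith.const r).lipschitzOnWith.absolutelyContinuousOnInterval
  have h : IsHorizontal (fun _ : ℝ => p) 0 0 :=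
    ⟨fun j => hc _, fun j => hc _, hc _, by simp⟩
  have := ccDist_le le_rfl h
  simpa [length] using this

theorem ccDist_comm_le (p q : Heis n) : ccDist p q ≤ ccDist q p := by
  refine le_iInf fun γ => le_iInf fun a => le_iInf fun b => le_iInf fun ⟨hab, h, ha, hb⟩ => ?_
  have := ccDist_le (neg_le_neg hab) h.reverse
  simpa only [neg_neg, ha, hb, length_reverse] using this

theorem ccDist_triangle (p q r : Heis n) : ccDist p r ≤ ccDist p q + ccDist q r := by
  classical
  simp only [ccDist, ENNReal.iInf_add, ENNReal.add_iInf]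
  refine le_iInf fun γ₂ => le_iInf fun c => le_iInf fun d => le_iInf fun ⟨hcd, h₂, hc, hd⟩ =>
    le_iInf fun γ₁ => le_iInf fun a => le_iInf fun b => le_iInf fun ⟨hab, h₁, ha, hb⟩ => ?_
  have h₃ := h₂.shift (c - b)
  have l₃ := length_shift γ₂ c d (c - b)
  have e : c - (c - b) = b := by ring
  rw [e] at h₃ l₃
  have hbd : b ≤ d - (c - b) := by linarith
  have hg := IsHorizontal.glue hab hbd (by simp [hb, hc]) h₁ h₃
  have hl := length_glue γ₁ (fun s => γ₂ (s + (c - b))) hab hbd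
  rw [l₃] at hl
  refine le_trans ?_ hl
  refine iInf_le_of_le _ (iInf_le_of_le a (iInf_le_of_le (d - (c - b))
    (iInf_le_of_le ⟨hab.trans hbd, hg, ?_, ?_⟩ le_rfl)))
  · simp [hab, ha]
  · rcases hbd.eq_or_lt with h' | h'
    · have hdc : d = c := by linarith
      subst hdc
      simp [hb, ← hd, hc]
    · simp only [if_neg (not_le.2 h'), sub_add_cancel, hd]

/-- `ℍ^n` with the Carnot-Carathéodory distance. (The distance is in fact finite and separates
points when `n ≥ 1`.) -/
noncomputable instance : PseudoEMetricSpace (Heis n) where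
  edist := ccDist
  edist_self := ccDist_self
  edist_comm p q := le_antisymm (ccDist_comm_le p q) (ccDist_comm_le q p)
  edist_triangle := ccDist_triangle

end Heis

/-! ## Sobolev maps into the Heisenberg group -/

/-- The weak contact equation `∇h = 2 ∑ (g_j ∇f_j - f_j ∇g_j)` almost everywhere in `Ω`, for a map
`F = (f_1, g_1, …, f_n, g_n, h)` whose components have weak partial derivatives. -/
def WeakContact {m n : ℕ} (Ω : Set (EuclideanSpace ℝ (Fin m)))
    (F : EuclideanSpace ℝ (Fin m) → Heis n) : Prop :=
  ∀ k : Fin m, ∃ (f' g' : Fin n → EuclideanSpace ℝ (Fin m) → ℝ)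
      (h' : EuclideanSpace ℝ (Fin m) → ℝ),
    (∀ j, IsWeakPartial Ω k (fun x => (F x).x j) (f' j)) ∧
    (∀ j, IsWeakPartial Ω k (fun x => (F x).y j) (g' j)) ∧
    IsWeakPartial Ω k (fun x => (F x).t) h' ∧
    ∀ᵐ x ∂(volume.restrict Ω),
      h' x = 2 * ∑ j, ((F x).y j * f' j x - (F x).x j * g' j x)

/-- The class `W^{1,p}(Ω, ℍ^n)`: all components are in `W^{1,p}(Ω)`, and the weak contact equation
holds. -/
def SobolevHeis {m : ℕ} (n : ℕ) (p : ℝ≥0∞) (Ω : Set (EuclideanSpace ℝ (Fin m))) :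
    Set (EuclideanSpace ℝ (Fin m) → Heis n) :=
  {F | (∀ j, (fun x => (F x).x j) ∈ SobolevReal p Ω) ∧
    (∀ j, (fun x => (F x).y j) ∈ SobolevReal p Ω) ∧
    (fun x => (F x).t) ∈ SobolevReal p Ω ∧
    WeakContact Ω F}

/-! Both inclusions are decided on segments parallel to a coordinate axis. By Fubini, an integrable
function with an integrable weak partial derivative satisfies the fundamental theorem of calculus on
almost every such segment (`ae_sub_eq_integral_of_weak`, `ae_ae_sub_eq_integral_of_weak`), and this
property in turn characterizes the weak partial derivative (`weak_of_ae_sub_eq_integral`).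

From `SobolevHeis` to `ARSobolev`: on almost every segment, `F` agrees almost everywhere with the
curve whose coordinates are primitives of the weak partials. The contact equation says that this
curve is horizontal, and its length is at most the integral of the sum `g` of the absolute values of
the partials of the `x_j` and `y_j`. A `K`-Lipschitz `φ` therefore changes by at most `K ∫ g` along
it, which `exists_weak_of_segments` converts into a weak partial of `φ ∘ F` bounded by `K g`
(`exists_isWeakPartial_comp`).

Conversely, the coordinates `x_j`, `y_j` are 1-Lipschitz, and `t` is Lipschitz on bounded sets, so
the components of a bounded `F` are Sobolev. Applying the bound by `g` to the distances from a
countable dense set gives `d(F(x), F(x + s e)) ≤ ∫_0^s g` (`ae_ccDist_le_integral`). The height of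
`p⁻¹ q` is at most `4 n d(p, q)²` (`abs_heightGap_le_toReal`), so between `F(x)` and `F(x + s e)` it
is `O(s²)` along `s = 1/(N+1)` for almost every `x`. Its first-order coefficient is the defect in
the contact equation, which must vanish (`ae_contact`). -/

/-! ### Segments in a fixed direction: Fubini and Lebesgue differentiation -/

section Lines

open Filter Topology

variable {E : Type*} [NormedAddCommGroup E] [NormedSpace ℝ E]

/-- The points `x` for which the segment `[x, x + δ e]` is contained in `Ω`. -/
def segmentBase (Ω : Set E) (e : E) (δ : ℝ) : Set E :=
  {x | ∀ r ∈ Icc (0 : ℝ) δ, x + r • e ∈ Ω}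

theorem isOpen_segmentBase {Ω : Set E} (hΩ : IsOpen Ω) (e : E) (δ : ℝ) :
    IsOpen (segmentBase Ω e δ) := by
  rw [isOpen_iff_mem_nhds]
  intro x hx
  have : ∀ r ∈ Icc (0 : ℝ) δ, ∀ᶠ z : E × ℝ in 𝓝 x ×ˢ 𝓝 r, z.1 + z.2 • e ∈ Ω := by
    intro r hr
    rw [← nhds_prod_eq]
    have hc : Continuous fun z : E × ℝ => z.1 + z.2 • e := by fun_prop
    exact hc.continuousAt.eventually (hΩ.mem_nhds (hx r hr))
  exact isCompact_Icc.eventually_forall_of_forall_eventually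
    (P := fun x r => x + r • e ∈ Ω) (fun r hr => by simpa [nhds_prod_eq] using this r hr)

theorem segmentBase_subset {Ω : Set E} {e : E} {δ r : ℝ} (hr : r ≤ δ) :
    segmentBase Ω e δ ⊆ segmentBase Ω e r :=
  fun _ hx s hs => hx s ⟨hs.1, hs.2.trans hr⟩

theorem IsCompact.exists_forall_add_smul_mem {Ω K : Set E} (hK : IsCompact K) (hΩ : IsOpen Ω)
    (hKΩ : K ⊆ Ω) (e : E) :
    ∃ δ > 0, ∀ x ∈ K, ∀ r : ℝ, |r| ≤ δ → x + r • e ∈ Ω := by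
  obtain ⟨ε, hε, h⟩ := hK.exists_cthickening_subset_open hΩ hKΩ
  refine ⟨ε / (‖e‖ + 1), by positivity, fun x hx r hr => h ?_⟩
  refine Metric.mem_cthickening_of_dist_le _ x _ _ hx ?_
  rw [dist_eq_norm, add_sub_cancel_left, norm_smul, Real.norm_eq_abs]
  calc |r| * ‖e‖ ≤ ε / (‖e‖ + 1) * (‖e‖ + 1) := by gcongr; linarith
    _ = ε := by field_simp

variable [MeasurableSpace E] [BorelSpace E] {μ : Measure E} [μ.IsAddHaarMeasure]

theorem ae_add_smul {P : E → Prop} (h : ∀ᵐ x ∂μ, P x) (e : E) (r : ℝ) :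
    ∀ᵐ x ∂μ, P (x + r • e) :=
  (measurePreserving_add_right μ (r • e)).quasiMeasurePreserving.ae h

variable [FiniteDimensional ℝ E]

theorem measurable_add_smul (e : E) : Measurable fun z : E × ℝ => z.1 + z.2 • e := by
  fun_prop

/-- Every slice at fixed `r` is a translation, so by Fubini preimages of null sets are null. This is
the source of the statements about almost every line. -/
theorem quasiMeasurePreserving_add_smul (e : E) (ν : Measure ℝ) [SFinite ν] :
    Measure.QuasiMeasurePreserving (fun z : E × ℝ => z.1 + z.2 • e) (μ.prod ν) μ := by
  refine ⟨measurable_add_smul e, Measure.AbsolutelyContinuous.mk fun s hs h0 => ?_⟩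
  rw [Measure.map_apply (measurable_add_smul e) hs,
    Measure.prod_apply_symm (measurable_add_smul e hs)]
  refine (lintegral_congr fun r => ?_).trans lintegral_zero
  exact (measurePreserving_add_right μ (r • e)).quasiMeasurePreserving.preimage_null h0

theorem ae_ae_add_smul {P : E → Prop} (h : ∀ᵐ x ∂μ, P x) (e : E) :
    ∀ᵐ x ∂μ, ∀ᵐ r : ℝ, P (x + r • e) :=
  Measure.ae_ae_of_ae_prod ((quasiMeasurePreserving_add_smul e volume).ae h)

theorem integrable_prod_add_smul {v : E → ℝ} (hv : Integrable v μ) (e : E) (ν : Measure ℝ)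
    [IsFiniteMeasure ν] : Integrable (fun z : E × ℝ => v (z.1 + z.2 • e)) (μ.prod ν) := by
  have hm := hv.1.comp_quasiMeasurePreserving (quasiMeasurePreserving_add_smul e ν)
  simp only [Function.comp_def] at hm
  rw [integrable_prod_iff' hm]
  refine ⟨.of_forall fun r => hv.comp_add_right (r • e), ?_⟩
  simp only [integral_add_right_eq_self (fun x => ‖v x‖)]
  exact integrable_const _

theorem ae_intervalIntegrable_add_smul {v : E → ℝ} (hv : Integrable v μ) (e : E) :
    ∀ᵐ x ∂μ, ∀ a b, IntervalIntegrable (fun r => v (x + r • e)) volume a b := by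
  have h : ∀ N : ℕ, ∀ᵐ x ∂μ, Integrable (fun r => v (x + r • e))
      (volume.restrict (Icc (-N : ℝ) N)) := fun N =>
    (integrable_prod_add_smul hv e _).prod_right_ae
  filter_upwards [ae_all_iff.2 h] with x hx a b
  obtain ⟨N, hN⟩ := exists_nat_ge (max |a| |b|)
  have ha := abs_le.1 ((le_max_left _ _).trans hN)
  have hb := abs_le.1 ((le_max_right _ _).trans hN)
  have : IntegrableOn (fun r => v (x + r • e)) (uIcc a b) :=
    IntegrableOn.mono_set (hx N) (uIcc_subset_Icc ha hb)
  exact this.intervalIntegrable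

/-- A measurable property that holds almost everywhere on almost every short segment with
direction `e` holds almost everywhere. -/
theorem ae_of_ae_ae_add_smul {Ω : Set E} (hΩ : IsOpen Ω) {e : E} {P : E → Prop}
    (hP : MeasurableSet {x | P x})
    (h : ∀ δ > 0, ∀ᵐ x ∂μ, x ∈ segmentBase Ω e δ → ∀ᵐ r : ℝ, r ∈ Ioo 0 δ → P (x + r • e)) :
    ∀ᵐ x ∂μ, x ∈ Ω → P x := by
  -- Exchanging the two almost-everywhere quantifiers, which needs measurability of `P`, produces a
  -- single shift `r` good for almost every `x`; translating back by `r` puts the conclusion at `x`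
  -- itself.
  have key : ∀ N : ℕ, ∃ r ∈ Ioo (0 : ℝ) (1 / (N + 1)),
      ∀ᵐ x ∂μ, x + (-r) • e ∈ segmentBase Ω e (1 / (N + 1)) → P x := by
    intro N
    have hδ : (0 : ℝ) < 1 / (N + 1) := by positivity
    have h1 : ∀ᵐ x ∂μ, ∀ᵐ r : ℝ, x ∈ segmentBase Ω e (1 / (N + 1)) → r ∈ Ioo (0 : ℝ) (1 / (N + 1)) →
        P (x + r • e) := by
      filter_upwards [h _ hδ] with x hx
      by_cases hm : x ∈ segmentBase Ω e (1 / (N + 1))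
      · filter_upwards [hx hm] with r hr _ using hr
      · exact .of_forall fun r hr => absurd hr hm
    rw [Measure.ae_ae_comm] at h1
    · have : (ae (volume.restrict (Ioo (0 : ℝ) (1 / (N + 1))))).NeBot := by
        rw [ae_neBot, Ne, Measure.restrict_eq_zero, Real.volume_Ioo]
        simpa using (by positivity : (0 : ℝ) < (N : ℝ) + 1)
      obtain ⟨r, hr1, hr2⟩ := ((ae_restrict_of_ae h1).and
        (ae_restrict_mem (measurableSet_Ioo : MeasurableSet (Ioo (0 : ℝ) (1 / (N + 1)))))).exists
      refine ⟨r, hr2, ?_⟩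
      filter_upwards [ae_add_smul hr1 e (-r)] with x hx hm
      have := hx hm hr2
      simpa using this
    · have m1 : MeasurableSet {z : E × ℝ | z.1 ∈ segmentBase Ω e (1 / (N + 1))} :=
        measurable_fst (isOpen_segmentBase hΩ e _).measurableSet
      have m2 : MeasurableSet {z : E × ℝ | z.2 ∈ Ioo (0 : ℝ) (1 / (N + 1))} :=
        measurable_snd measurableSet_Ioo
      have m3 : MeasurableSet {z : E × ℝ | P (z.1 + z.2 • e)} := measurable_add_smul e hP
      exact m1.imp (m2.imp m3)
  choose r hr hP' using key
  filter_upwards [ae_all_iff.2 hP'] with x hx hxΩ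
  -- For `N` large the segment of length `1/(N+1)` starting at `x - r_N e` stays in `Ω`, since its
  -- points differ from `x` by at most `1/(N+1)` in the parameter.
  obtain ⟨δ, hδ, hδΩ⟩ := (isCompact_singleton (x := x)).exists_forall_add_smul_mem hΩ
    (by simpa using hxΩ) e
  obtain ⟨N, hN⟩ := exists_nat_one_div_lt hδ
  refine hx N fun s hs => ?_
  have := hδΩ x rfl (-r N + s) ?_
  · rwa [add_smul, ← add_assoc] at this
  · have := hr N
    rw [abs_le]
    constructor <;> linarith [this.1, this.2, hs.1, hs.2]

/-- Lebesgue differentiation along the lines in direction `e`. -/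
theorem ae_tendsto_average_add_smul {v : E → ℝ} (hv : Integrable v μ) (e : E) :
    ∀ᵐ x ∂μ, Tendsto (fun N : ℕ => ((N : ℝ) + 1) * ∫ r in (0 : ℝ)..1 / (N + 1), v (x + r • e))
      atTop (𝓝 (v x)) := by
  -- A measurable representative makes the set of convergence measurable, so the one-dimensional
  -- differentiation theorem can be transferred from lines. Almost every line sees the change of
  -- representative only on a null set.
  wlog hm : StronglyMeasurable v generalizing v
  · have hae := hv.1.ae_eq_mk
    filter_upwards [this (hv.congr hae) hv.1.stronglyMeasurable_mk, hae, ae_ae_add_smul hae e]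
      with x hx hx' hl
    rw [hx']
    convert hx using 3 with N
    refine intervalIntegral.integral_congr_ae ?_
    filter_upwards [hl] with r hr _ using hr
  have hmeas : MeasurableSet {x : E | Tendsto
      (fun N : ℕ => ((N : ℝ) + 1) * ∫ r in (0 : ℝ)..1 / (N + 1), v (x + r • e)) atTop
        (𝓝 (v x))} := by
    refine measurableSet_tendsto_fun (fun N => ?_) hm.measurable
    have h0 : (0 : ℝ) ≤ 1 / (N + 1) := by positivity
    simp only [intervalIntegral.integral_of_le h0]
    refine Measurable.const_mul (StronglyMeasurable.measurable ?_) _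
    exact StronglyMeasurable.integral_prod_right'
      (f := fun z : E × ℝ => v (z.1 + z.2 • e)) (hm.comp_measurable (measurable_add_smul e))
  have := ae_of_ae_ae_add_smul (μ := μ) isOpen_univ hmeas (e := e) ?_
  · simpa using this
  intro δ hδ
  filter_upwards [ae_intervalIntegrable_add_smul hv e] with x hx _
  filter_upwards [(hx 0 δ).ae_hasDerivAt_integral] with r hr hrδ
  have hr' : r ∈ uIcc 0 δ := by rw [uIcc_of_le hδ.le]; exact Ioo_subset_Icc_self hrδ
  have h1 := hr hr' r hr'
  have h2 : Tendsto (fun N : ℕ => (1 : ℝ) / (N + 1)) atTop (𝓝[≠] 0) := by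
    refine tendsto_nhdsWithin_iff.2 ⟨tendsto_one_div_add_atTop_nhds_zero_nat, .of_forall fun N => ?_⟩
    have : (0 : ℝ) < 1 / (N + 1) := by positivity
    exact this.ne'
  have h3 := (hasDerivAt_iff_tendsto_slope_zero.1 h1).comp h2
  refine h3.congr fun N => ?_
  simp only [Function.comp, intervalIntegral.integral_same, sub_zero, one_div, inv_inv, smul_eq_mul]
  congr 1
  rw [← sub_add_cancel r r, sub_self, zero_add]
  have := intervalIntegral.integral_comp_add_right (a := 0) (b := ((N : ℝ) + 1)⁻¹)
    (fun s => v (x + s • e)) r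
  rw [zero_add, add_comm _ r] at this
  rw [← this]
  refine intervalIntegral.integral_congr fun s _ => ?_
  simp only [add_smul]
  congr 1
  abel

end Lines

/-! ### Weak derivatives and the fundamental theorem of calculus on segments -/

section WeakDerivativeOnLines

theorem integrable_mul_test {E : Type*} [NormedAddCommGroup E] [MeasurableSpace E] [BorelSpace E]
    {μ : Measure E} {u ψ : E → ℝ} (hu : Integrable u μ) (hψ : Continuous ψ) (hc : HasCompactSupport ψ)
    [SecondCountableTopology E] : Integrable (fun x => u x * ψ x) μ := by
  obtain ⟨C, hC⟩ := hc.exists_bound_of_continuous hψ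
  exact hu.mul_bdd (c := C) hψ.aestronglyMeasurable (.of_forall hC)

open Filter Topology

variable {E : Type*} [NormedAddCommGroup E] [NormedSpace ℝ E]

theorem HasCompactSupport.comp_sub_smul {ψ : E → ℝ} (hψ : HasCompactSupport ψ) (e : E) (r : ℝ) :
    HasCompactSupport fun x => ψ (x - r • e) :=
  hψ.comp_isClosedEmbedding (g := fun x => x - r • e) (Homeomorph.subRight (r • e)).isClosedEmbedding

theorem sub_smul_mem_tsupport {ψ : E → ℝ} {e : E} {r : ℝ} {x : E}
    (h : x ∈ tsupport fun x => ψ (x - r • e)) : x - r • e ∈ tsupport ψ :=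
  tsupport_comp_subset_preimage ψ (f := fun x => x - r • e) (by fun_prop) h

variable [MeasurableSpace E] [BorelSpace E] {μ : Measure E}

section

variable [FiniteDimensional ℝ E]

/-- With the translation placed on the smooth factor, differentiation under the integral asks
nothing of `u` beyond integrability. -/
theorem hasDerivAt_integral_mul_test {u ψ : E → ℝ} (hu : Integrable u μ)
    (hψ : ContDiff ℝ ∞ ψ) (hc : HasCompactSupport ψ) (e : E) (r : ℝ) :
    HasDerivAt (fun r : ℝ => ∫ x, u x * ψ (x - r • e) ∂μ)
      (-∫ x, u x * fderiv ℝ ψ (x - r • e) e ∂μ) r := by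
  have hdc : Continuous fun x => fderiv ℝ ψ x e :=
    (hψ.continuous_fderiv (by simp)).clm_apply continuous_const
  obtain ⟨C, hC⟩ := (hc.fderiv_apply (𝕜 := ℝ) e).exists_bound_of_continuous hdc
  rw [← integral_neg]
  refine (hasDerivAt_integral_of_dominated_loc_of_deriv_le (s := univ) (bound := fun x => |u x| * C)
    (F' := fun r x => -(u x * fderiv ℝ ψ (x - r • e) e)) univ_mem (.of_forall fun s => ?_) ?_ ?_ ?_ ?_ ?_).2
  · exact (integrable_mul_test hu (hψ.continuous.comp (by fun_prop)) (hc.comp_sub_smul e s)).1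
  · exact integrable_mul_test hu (hψ.continuous.comp (by fun_prop)) (hc.comp_sub_smul e r)
  · exact (hu.1.mul (hdc.comp (by fun_prop : Continuous fun x => x - r • e)).aestronglyMeasurable).neg
  · refine .of_forall fun x s _ => ?_
    rw [norm_neg, norm_mul]
    exact mul_le_mul_of_nonneg_left (hC _) (norm_nonneg _)
  · exact hu.abs.mul_const C
  · refine .of_forall fun x s _ => ?_
    have h1 : HasDerivAt (fun s : ℝ => x - s • e) (-e) s := by
      simpa using ((hasDerivAt_id s).smul_const e).const_sub x
    have h2 := ((hψ.differentiable (by simp)) (x - s • e)).hasFDerivAt.comp_hasDerivAt s h1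
    simpa using h2.const_mul (u x)

theorem continuous_integral_mul_test {v ψ : E → ℝ} (hv : Integrable v μ)
    (hψ : Continuous ψ) (hc : HasCompactSupport ψ) (e : E) :
    Continuous fun r : ℝ => ∫ x, v x * ψ (x - r • e) ∂μ := by
  obtain ⟨C, hC⟩ := hc.exists_bound_of_continuous hψ
  refine continuous_of_dominated (bound := fun x => |v x| * C) (fun r => ?_) (fun r => ?_)
    (hv.abs.mul_const C) (.of_forall fun x => ?_)
  · exact (integrable_mul_test hv (hψ.comp (by fun_prop)) (hc.comp_sub_smul e r)).1
  · refine .of_forall fun x => ?_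
    rw [norm_mul]
    exact mul_le_mul_of_nonneg_left (hC _) (norm_nonneg _)
  · exact continuous_const.mul (hψ.comp (by fun_prop))

end

variable [μ.IsAddHaarMeasure]

theorem integral_add_smul_mul_test {u ψ : E → ℝ} (e : E) (s : ℝ) :
    ∫ x, u (x + s • e) * ψ x ∂μ = ∫ x, u x * ψ (x - s • e) ∂μ := by
  rw [← integral_add_right_eq_self (fun x => u x * ψ (x - s • e)) (s • e)]
  simp

variable [FiniteDimensional ℝ E]

theorem integrable_integral_add_smul {v : E → ℝ} (hv : Integrable v μ) (e : E) {s : ℝ}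
    (hs : 0 ≤ s) : Integrable (fun x => ∫ r in (0 : ℝ)..s, v (x + r • e)) μ := by
  simp only [intervalIntegral.integral_of_le hs]
  exact (integrable_prod_add_smul hv e (volume.restrict (Ioc 0 s))).integral_prod_left

theorem integral_integral_add_smul_mul_test {v ψ : E → ℝ} (hv : Integrable v μ)
    (hψ : Continuous ψ) (hc : HasCompactSupport ψ) (e : E) {s : ℝ} (hs : 0 ≤ s) :
    ∫ x, (∫ r in (0 : ℝ)..s, v (x + r • e)) * ψ x ∂μ =
      ∫ r in (0 : ℝ)..s, ∫ x, v x * ψ (x - r • e) ∂μ := by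
  simp only [intervalIntegral.integral_of_le hs, ← integral_add_smul_mul_test, ← integral_mul_const]
  refine integral_integral_swap ?_
  obtain ⟨C, hC⟩ := hc.exists_bound_of_continuous hψ
  exact (integrable_prod_add_smul hv e (volume.restrict (Ioc 0 s))).mul_bdd (c := C)
    (hψ.comp continuous_fst).aestronglyMeasurable (.of_forall fun z => hC z.1)

theorem integral_sub_mul_test {u v ψ : E → ℝ} (hu : Integrable u μ) (hv : Integrable v μ)
    (hψ : Continuous ψ) (hc : HasCompactSupport ψ) (e : E) {s : ℝ} (hs : 0 ≤ s) :
    ∫ x, (u (x + s • e) - u x - ∫ r in (0 : ℝ)..s, v (x + r • e)) * ψ x ∂μ =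
      ∫ x, u x * ψ (x - s • e) ∂μ - ∫ x, u x * ψ (x - (0 : ℝ) • e) ∂μ -
        ∫ r in (0 : ℝ)..s, ∫ x, v x * ψ (x - r • e) ∂μ := by
  have h1 := integrable_mul_test (hu.comp_add_right (s • e)) hψ hc
  have h2 := integrable_mul_test hu hψ hc
  have h3 := integrable_mul_test (integrable_integral_add_smul hv e hs) hψ hc
  simp only [sub_mul]
  have h12 : ∫ x, (u (x + s • e) * ψ x - u x * ψ x) -
      (∫ r in (0 : ℝ)..s, v (x + r • e)) * ψ x ∂μ = _ := integral_sub (h1.sub h2) h3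
  rw [h12, integral_sub h1 h2, integral_add_smul_mul_test,
    integral_integral_add_smul_mul_test hv hψ hc e hs]
  simp

/-- A function with weak derivative `v` in direction `e` satisfies the fundamental theorem of
calculus on almost every segment with direction `e`. -/
theorem ae_sub_eq_integral_of_weak {Ω : Set E} (hΩ : IsOpen Ω) {e : E} {u v : E → ℝ}
    (hu : Integrable u μ) (hv : Integrable v μ)
    (hw : ∀ φ : E → ℝ, ContDiff ℝ ∞ φ → HasCompactSupport φ → tsupport φ ⊆ Ω →
      ∫ x, u x * fderiv ℝ φ x e ∂μ = -∫ x, v x * φ x ∂μ) {s : ℝ} (hs : 0 ≤ s) :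
    ∀ᵐ x ∂μ, x ∈ segmentBase Ω e s →
      u (x + s • e) - u x = ∫ r in (0 : ℝ)..s, v (x + r • e) := by
  have hD : Integrable (fun x => u (x + s • e) - u x - ∫ r in (0 : ℝ)..s, v (x + r • e)) μ :=
    ((hu.comp_add_right _).sub hu).sub (integrable_integral_add_smul hv e hs)
  have := (isOpen_segmentBase hΩ e s).ae_eq_zero_of_integral_contDiff_smul_eq_zero
    (hD.locallyIntegrable.locallyIntegrableOn _) ?_
  · filter_upwards [this] with x hx hm
    exact sub_eq_zero.1 (hx hm)
  -- Tested against `ψ`, the claim becomes the fundamental theorem of calculus for `r ↦ ∫ u ψ(· - r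
  -- e)`. The weak derivative is applied to the translates of `ψ`; their supports lie in `Ω` for `r
  -- ∈ [0, s]` because `ψ` is supported in `segmentBase Ω e s`.
  intro ψ hψ hc hsupp
  simp only [smul_eq_mul, mul_comm (ψ _)]
  rw [integral_sub_mul_test hu hv hψ.continuous hc e hs, sub_eq_zero]
  symm
  refine intervalIntegral.integral_eq_sub_of_hasDerivAt
    (f := fun r : ℝ => ∫ x, u x * ψ (x - r • e) ∂μ) (fun r hr => ?_)
    ((continuous_integral_mul_test hv hψ.continuous hc e).intervalIntegrable _ _)
  rw [uIcc_of_le hs] at hr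
  have := hw (fun x => ψ (x - r • e)) (hψ.comp (by fun_prop)) (hc.comp_sub_smul e r)
    (fun x hx => by
      have := hsupp (sub_smul_mem_tsupport hx) r hr
      simpa using this)
  simp only [fderiv_comp_sub] at this
  have h1 := hasDerivAt_integral_mul_test hu hψ hc e r
  rwa [this, neg_neg] at h1

/-- The fundamental theorem of calculus on almost every short segment gives the weak derivative. -/
theorem weak_of_ae_sub_eq_integral {Ω : Set E} (hΩ : IsOpen Ω) {e : E} {u v : E → ℝ}
    (hu : Integrable u μ) (hv : Integrable v μ)
    (h : ∀ s > 0, ∀ᵐ x ∂μ, x ∈ segmentBase Ω e s →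
      u (x + s • e) - u x = ∫ r in (0 : ℝ)..s, v (x + r • e))
    {ψ : E → ℝ} (hψ : ContDiff ℝ ∞ ψ) (hc : HasCompactSupport ψ) (hsupp : tsupport ψ ⊆ Ω) :
    ∫ x, u x * fderiv ℝ ψ x e ∂μ = -∫ x, v x * ψ x ∂μ := by
  obtain ⟨δ, hδ, hδΩ⟩ := hc.exists_forall_add_smul_mem hΩ hsupp e
  have hG := hasDerivAt_integral_mul_test hu hψ hc e 0
  have hcont := continuous_integral_mul_test hv hψ.continuous hc e
  have hH := intervalIntegral.integral_hasDerivAt_right (hcont.intervalIntegrable 0 0)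
    hcont.stronglyMeasurable.stronglyMeasurableAtFilter hcont.continuousAt
  have hGH : ∀ s ∈ Icc 0 δ, (∫ x, u x * ψ (x - s • e) ∂μ) =
      (∫ r in (0 : ℝ)..s, ∫ x, v x * ψ (x - r • e) ∂μ) + ∫ x, u x * ψ (x - (0 : ℝ) • e) ∂μ := by
    intro s hs
    rcases hs.1.eq_or_lt with rfl | hs0
    · simp
    have h1 := integral_sub_mul_test hu hv hψ.continuous hc e hs.1
    rw [integral_eq_zero_of_ae] at h1
    · linarith
    filter_upwards [h s hs0] with x hx
    by_cases hm : x ∈ tsupport ψ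
    · have : x ∈ segmentBase Ω e s := fun r hr => hδΩ x hm r
        (by rw [abs_of_nonneg hr.1]; exact hr.2.trans hs.2)
      simp [hx this]
    · simp [image_eq_zero_of_notMem_tsupport hm]
  -- The identity `hGH` holds only for nonnegative `s`, so the two derivatives at `0` are compared
  -- from the right.
  have hU : UniqueDiffWithinAt ℝ (Icc 0 δ) 0 := uniqueDiffOn_Icc hδ 0 ⟨le_rfl, hδ.le⟩
  have h1 := hG.hasDerivWithinAt (s := Icc 0 δ)
  have h2 := (hH.add_const (∫ x, u x * ψ (x - (0 : ℝ) • e) ∂μ)).hasDerivWithinAt (s := Icc 0 δ)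
  have h3 := hU.eq_deriv _ h1 (h2.congr hGH (hGH 0 ⟨le_rfl, hδ.le⟩))
  simp only [zero_smul, sub_zero] at h3
  rw [← h3, neg_neg]

end WeakDerivativeOnLines

/-! ### Constructing a weak derivative from its behaviour on segments -/

section LineCurves

open Filter Topology

theorem AbsolutelyContinuousOnInterval.of_dist_le {U V : ℝ → ℝ} {a b : ℝ}
    (hV : AbsolutelyContinuousOnInterval V a b)
    (h : ∀ s ∈ uIcc a b, ∀ t ∈ uIcc a b, dist (U s) (U t) ≤ dist (V s) (V t)) :
    AbsolutelyContinuousOnInterval U a b := by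
  rw [absolutelyContinuousOnInterval_iff] at hV ⊢
  intro ε hε
  obtain ⟨δ, hδ, H⟩ := hV ε hε
  refine ⟨δ, hδ, fun E hE hs => ?_⟩
  exact (Finset.sum_le_sum fun i hi => h _ (hE.1 i hi).1 _ (hE.1 i hi).2).trans_lt (H E hE hs)

theorem AbsolutelyContinuousOnInterval.of_abs_sub_le_integral {U w : ℝ → ℝ} {a b : ℝ}
    (hab : a ≤ b) (hw : IntervalIntegrable w volume a b)
    (h : ∀ s t, a ≤ s → s ≤ t → t ≤ b → |U t - U s| ≤ ∫ r in s..t, w r) :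
    AbsolutelyContinuousOnInterval U a b := by
  have hwi : ∀ s ∈ Icc a b, ∀ t ∈ Icc a b, IntervalIntegrable w volume s t := fun s hs t ht =>
    hw.mono_set (by rw [uIcc_of_le hab]; exact uIcc_subset_Icc hs ht)
  have key : ∀ s t, a ≤ s → s ≤ t → t ≤ b →
      |U t - U s| ≤ |(∫ r in a..t, w r) - ∫ r in a..s, w r| := by
    intro s t hs hst ht
    have has : a ∈ Icc a b := ⟨le_rfl, hab⟩
    rw [intervalIntegral.integral_interval_sub_left
      (hwi a has t ⟨hs.trans hst, ht⟩) (hwi a has s ⟨hs, hst.trans ht⟩)]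
    exact (h s t hs hst ht).trans (le_abs_self _)
  refine (hw.absolutelyContinuousOnInterval_intervalIntegral left_mem_uIcc).of_dist_le ?_
  intro s hs t ht
  rw [uIcc_of_le hab] at hs ht
  rcases le_total s t with hst | hst
  · rw [dist_comm, dist_comm (∫ _ in a..s, _)]
    exact key s t hs.1 hst ht.2
  · exact key t s ht.1 hst hs.2

theorem tendsto_slope_one_div {U : ℝ → ℝ} {U' r : ℝ} (h : HasDerivAt U U' r) :
    Tendsto (fun N : ℕ => ((N : ℝ) + 1) * (U (r + 1 / (N + 1)) - U r)) atTop (𝓝 U') := by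
  have h2 : Tendsto (fun N : ℕ => (1 : ℝ) / (N + 1)) atTop (𝓝[≠] 0) := by
    refine tendsto_nhdsWithin_iff.2 ⟨tendsto_one_div_add_atTop_nhds_zero_nat, .of_forall fun N => ?_⟩
    have : (0 : ℝ) < 1 / (N + 1) := by positivity
    exact this.ne'
  refine ((hasDerivAt_iff_tendsto_slope_zero.1 h).comp h2).congr fun N => ?_
  simp

variable {E : Type*} [NormedAddCommGroup E] [NormedSpace ℝ E]
  [MeasurableSpace E] [BorelSpace E] [FiniteDimensional ℝ E] {μ : Measure E} [μ.IsAddHaarMeasure]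

/-- If, on almost every short segment with direction `e`, the function `u` agrees almost
everywhere with a function whose increments are bounded by the integral of `g`, then `u` has a
weak derivative in direction `e` which is bounded by `g`. -/
theorem exists_weak_of_segments {Ω : Set E} (hΩ : IsOpen Ω) {e : E} {u g : E → ℝ}
    (hu : Integrable u μ) (hg : Integrable g μ)
    (h : ∀ δ > 0, ∀ᵐ x ∂μ, x ∈ segmentBase Ω e δ → ∃ U : ℝ → ℝ,
      U 0 = u x ∧ U δ = u (x + δ • e) ∧ (∀ᵐ r : ℝ, r ∈ Ioo 0 δ → U r = u (x + r • e)) ∧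
      ∀ a b, 0 ≤ a → a ≤ b → b ≤ δ → |U b - U a| ≤ ∫ r in a..b, g (x + r • e)) :
    ∃ v : E → ℝ, Integrable v μ ∧ (∀ᵐ x ∂μ, x ∈ Ω → |v x| ≤ g x) ∧
      ∀ ψ : E → ℝ, ContDiff ℝ ∞ ψ → HasCompactSupport ψ → tsupport ψ ⊆ Ω →
        ∫ x, u x * fderiv ℝ ψ x e ∂μ = -∫ x, v x * ψ x ∂μ := by
  obtain ⟨u', hu'm, huu'⟩ := hu.1
  obtain ⟨g', hg'm, hgg'⟩ := hg.1
  -- A limsup of difference quotients of a measurable representative is measurable and needs no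
  -- choice of `U`. The value of the real limsup where the quotients are unbounded is irrelevant: at
  -- almost every point of `Ω` they converge.
  set v : E → ℝ := fun x => limsup
    (fun N : ℕ => ((N : ℝ) + 1) * (u' (x + (1 / ((N : ℝ) + 1)) • e) - u' x)) atTop with hv
  have hvm : Measurable v := by
    refine Measurable.limsup fun N => Measurable.const_mul ?_ _
    exact (hu'm.measurable.comp (measurable_id.add_const _)).sub hu'm.measurable
  have key : ∀ δ > 0, ∀ᵐ x ∂μ, x ∈ segmentBase Ω e δ →
      (∀ᵐ r : ℝ, r ∈ Ioo 0 δ → |v (x + r • e)| ≤ g' (x + r • e)) ∧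
      u (x + δ • e) - u x = ∫ r in (0 : ℝ)..δ, v (x + r • e) := by
    intro δ hδ
    filter_upwards [h δ hδ, ae_intervalIntegrable_add_smul hg e, ae_ae_add_smul huu' e,
      ae_ae_add_smul hgg' e] with x hx hgi hul hgl hm
    obtain ⟨U, hU0, hUδ, hUu, hUg⟩ := hx hm
    have hac : AbsolutelyContinuousOnInterval U 0 δ :=
      .of_abs_sub_le_integral hδ.le (hgi 0 δ) fun s t => hUg s t
    -- `U` equals `u'` only for almost every parameter. Restricting to the countably many steps
    -- `1/(N+1)` lets both ends of every difference quotient avoid the exceptional set.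
    have hshift : ∀ᵐ r : ℝ, ∀ N : ℕ, r + 1 / ((N : ℝ) + 1) ∈ Ioo 0 δ →
        U (r + 1 / ((N : ℝ) + 1)) = u' (x + (r + 1 / ((N : ℝ) + 1)) • e) := by
      refine ae_all_iff.2 fun N => ?_
      have h1 : ∀ᵐ r : ℝ, r ∈ Ioo 0 δ → U r = u' (x + r • e) := by
        filter_upwards [hUu, hul] with r h1 h2 h3
        rw [h1 h3, h2]
      exact (measurePreserving_add_right volume (1 / ((N : ℝ) + 1))).quasiMeasurePreserving.ae h1
    have hder : ∀ᵐ r : ℝ, r ∈ Ioo 0 δ →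
        v (x + r • e) = deriv U r ∧ |v (x + r • e)| ≤ g' (x + r • e) := by
      filter_upwards [hUu, hul, hshift, hac.ae_differentiableAt, (hgi 0 δ).ae_hasDerivAt_integral,
        hgl] with r hr1 hr2 hr3 hr4 hr5 hr6 hr
      have hrc : r ∈ uIcc 0 δ := by rw [uIcc_of_le hδ.le]; exact Ioo_subset_Icc_self hr
      have hsmall : ∀ᶠ N : ℕ in atTop, r + 1 / ((N : ℝ) + 1) < δ := by
        have : Tendsto (fun N : ℕ => r + 1 / ((N : ℝ) + 1)) atTop (𝓝 (r + 0)) :=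
          tendsto_const_nhds.add tendsto_one_div_add_atTop_nhds_zero_nat
        exact this.eventually_lt_const (by simpa using hr.2)
      have ht := tendsto_slope_one_div (hr4 hrc).hasDerivAt
      have hvr : v (x + r • e) = deriv U r := by
        refine Tendsto.limsup_eq (ht.congr' ?_)
        filter_upwards [hsmall] with N hN
        have hpos : (0 : ℝ) < 1 / ((N : ℝ) + 1) := by positivity
        rw [hr3 N ⟨by linarith [hr.1], hN⟩, hr1 hr, hr2, add_smul, add_assoc]
      refine ⟨hvr, ?_⟩
      rw [hvr, ← hr6]
      have htg := tendsto_slope_one_div (hr5 hrc r hrc)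
      refine le_of_tendsto_of_tendsto ht.abs htg ?_
      filter_upwards [hsmall] with N hN
      have hpos : (0 : ℝ) < 1 / ((N : ℝ) + 1) := by positivity
      have hN0 : (0 : ℝ) < (N : ℝ) + 1 := by positivity
      rw [abs_mul, abs_of_pos hN0, intervalIntegral.integral_same, sub_zero]
      exact mul_le_mul_of_nonneg_left (hUg _ _ hr.1.le (by linarith) hN.le) hN0.le
    refine ⟨?_, ?_⟩
    · filter_upwards [hder] with r h1 h2 using (h1 h2).2
    · rw [← hU0, ← hUδ, ← hac.integral_deriv_eq_sub]
      refine intervalIntegral.integral_congr_ae ?_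
      filter_upwards [hder, Measure.ae_ne volume δ] with r h1 h2 h3
      rw [uIoc_of_le hδ.le] at h3
      exact (h1 ⟨h3.1, lt_of_le_of_ne h3.2 h2⟩).1.symm
  have hbound : ∀ᵐ x ∂μ, x ∈ Ω → |v x| ≤ g' x := by
    refine ae_of_ae_ae_add_smul hΩ (e := e) (measurableSet_le hvm.abs hg'm.measurable) ?_
    intro δ hδ
    filter_upwards [key δ hδ] with x hx hm using (hx hm).1
  -- Outside `Ω` the limsup is not controlled by `g`, hence the cut-off.
  have hvi : Integrable (Ω.indicator v) μ := by
    refine hg.mono (hvm.indicator hΩ.measurableSet).aestronglyMeasurable ?_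
    filter_upwards [hbound, hgg'] with x hx hx'
    by_cases hm : x ∈ Ω
    · rw [indicator_of_mem hm, hx']
      exact (hx hm).trans (le_abs_self _)
    · simp [indicator_of_notMem hm]
  refine ⟨Ω.indicator v, hvi, ?_, fun ψ hψ hc hs =>
    weak_of_ae_sub_eq_integral hΩ hu hvi (fun s hs => ?_) hψ hc hs⟩
  · filter_upwards [hbound, hgg'] with x hx hx' hm
    rw [indicator_of_mem hm, hx']
    exact hx hm
  · filter_upwards [key s hs] with x hx hm
    rw [(hx hm).2]
    refine intervalIntegral.integral_congr fun r hr => ?_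
    rw [uIcc_of_le hs.le] at hr
    rw [indicator_of_mem (hm r hr)]

end LineCurves

/-! ### Two-sided estimates of the Carnot-Carathéodory distance -/

namespace Heis

open Filter Topology

variable {n : ℕ}

/-- The last coordinate of `p⁻¹ q`. -/
def heightGap (p q : Heis n) : ℝ :=
  q.t - p.t - 2 * ∑ j, (p.y j * (q.x j - p.x j) - p.x j * (q.y j - p.y j))

theorem ac_affine (a b c d : ℝ) : AbsolutelyContinuousOnInterval (fun s : ℝ => a + s * b) c d := by
  have h : LipschitzWith ‖b‖₊ fun s : ℝ => a + s * b := by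
    refine LipschitzWith.of_dist_le_mul fun s t => le_of_eq ?_
    rw [Real.dist_eq, Real.dist_eq, coe_nnnorm, Real.norm_eq_abs, ← abs_mul]
    congr 1
    ring
  exact h.lipschitzOnWith.absolutelyContinuousOnInterval

/-- Along `s ↦ (x + s a, y + s b)` the terms `s b_j a_j` and `s a_j b_j` of the contact form cancel,
so the required vertical velocity is constant and an affine curve is horizontal. -/
theorem ccDist_segment_le (p : Heis n) (a b : Fin n → ℝ) :
    ccDist p ⟨p.x + a, p.y + b, p.t + 2 * ∑ j, (p.y j * a j - p.x j * b j)⟩ ≤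
      ENNReal.ofReal (Real.sqrt (∑ j, (a j ^ 2 + b j ^ 2))) := by
  set γ : ℝ → Heis n := fun s => ⟨fun j => p.x j + s * a j, fun j => p.y j + s * b j,
    p.t + s * (2 * ∑ j, (p.y j * a j - p.x j * b j))⟩ with hγ
  have hd : ∀ c d s : ℝ, deriv (fun r : ℝ => c + r * d) s = d := fun c d s => by
    simp
  have hh : IsHorizontal γ 0 1 := by
    refine ⟨fun j => ac_affine _ _ _ _, fun j => ac_affine _ _ _ _, ac_affine _ _ _ _,
      .of_forall fun s => ?_⟩
    simp only [hγ, hd]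
    congr 1
    exact Finset.sum_congr rfl fun j _ => by ring
  have hl : length γ 0 1 = ENNReal.ofReal (Real.sqrt (∑ j, (a j ^ 2 + b j ^ 2))) := by
    simp [length, speed, hγ, hd]
  rw [← hl]
  refine iInf_le_of_le γ (iInf_le_of_le 0 (iInf_le_of_le 1
    (iInf_le_of_le ⟨zero_le_one, hh, ?_, ?_⟩ le_rfl)))
  · ext <;> simp [hγ]
  · ext <;> simp [hγ]

theorem ccDist_single_x_le (p : Heis n) (j : Fin n) (a : ℝ) :
    ccDist p ⟨p.x + Pi.single j a, p.y, p.t + 2 * (p.y j * a)⟩ ≤ ENNReal.ofReal |a| := by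
  have := ccDist_segment_le p (Pi.single j a) 0
  simpa [Pi.single_apply, ite_pow, Real.sqrt_sq_eq_abs] using this

theorem ccDist_single_y_le (p : Heis n) (j : Fin n) (b : ℝ) :
    ccDist p ⟨p.x, p.y + Pi.single j b, p.t - 2 * (p.x j * b)⟩ ≤ ENNReal.ofReal |b| := by
  have := ccDist_segment_le p 0 (Pi.single j b)
  simpa [Pi.single_apply, ite_pow, Real.sqrt_sq_eq_abs, sub_eq_add_neg] using this

/-- The horizontal lift of a rectangle in the `(x_j, y_j)` plane does not close up: its height
changes by `-4` times the signed area, at the cost of the perimeter. -/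
theorem ccDist_commutator_le (p : Heis n) (j : Fin n) (a b : ℝ) :
    ccDist p ⟨p.x, p.y, p.t - 4 * (a * b)⟩ ≤ ENNReal.ofReal (2 * |a| + 2 * |b|) := by
  set q₁ : Heis n := ⟨p.x + Pi.single j a, p.y, p.t + 2 * (p.y j * a)⟩ with h₁
  set q₂ : Heis n := ⟨q₁.x, q₁.y + Pi.single j b, q₁.t - 2 * (q₁.x j * b)⟩ with h₂
  set q₃ : Heis n := ⟨q₂.x + Pi.single j (-a), q₂.y, q₂.t + 2 * (q₂.y j * -a)⟩ with h₃
  set q₄ : Heis n := ⟨q₃.x, q₃.y + Pi.single j (-b), q₃.t - 2 * (q₃.x j * -b)⟩ with h₄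
  have e : (⟨p.x, p.y, p.t - 4 * (a * b)⟩ : Heis n) = q₄ := by
    ext i
    · simp only [h₄, h₃, h₂, h₁, Pi.add_apply]
      rw [add_assoc, ← Pi.add_apply, ← Pi.single_add]
      simp
    · simp only [h₄, h₃, h₂, h₁, Pi.add_apply]
      rw [add_assoc, ← Pi.add_apply, ← Pi.single_add]
      simp
    · simp only [h₄, h₃, h₂, h₁, Pi.add_apply, Pi.single_eq_same]
      ring
  rw [e]
  have d₁ : ccDist p q₁ ≤ ENNReal.ofReal |a| := ccDist_single_x_le p j a
  have d₂ : ccDist q₁ q₂ ≤ ENNReal.ofReal |b| := ccDist_single_y_le q₁ j b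
  have d₃ : ccDist q₂ q₃ ≤ ENNReal.ofReal |(-a)| := ccDist_single_x_le q₂ j (-a)
  have d₄ : ccDist q₃ q₄ ≤ ENNReal.ofReal |(-b)| := ccDist_single_y_le q₃ j (-b)
  rw [abs_neg] at d₃ d₄
  calc ccDist p q₄ ≤ ccDist p q₁ + (ccDist q₁ q₂ + (ccDist q₂ q₃ + ccDist q₃ q₄)) :=
        (ccDist_triangle _ q₁ _).trans (add_le_add_right ((ccDist_triangle _ q₂ _).trans
          (add_le_add_right (ccDist_triangle _ q₃ _) _)) _)
    _ ≤ ENNReal.ofReal |a| + (ENNReal.ofReal |b| + (ENNReal.ofReal |a| + ENNReal.ofReal |b|)) := by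
        gcongr
    _ = ENNReal.ofReal (2 * |a| + 2 * |b|) := by
        rw [← ENNReal.ofReal_add, ← ENNReal.ofReal_add, ← ENNReal.ofReal_add] <;>
          first | positivity | (congr 1; ring)

theorem ccDist_vertical_le (hn : 1 ≤ n) (p : Heis n) (τ : ℝ) :
    ccDist p ⟨p.x, p.y, p.t + τ⟩ ≤ ENNReal.ofReal (2 * Real.sqrt |τ|) := by
  have hc := Real.mul_self_sqrt (abs_nonneg τ)
  set c := Real.sqrt |τ|
  have hc0 : 0 ≤ c := Real.sqrt_nonneg _
  have habs : |c / 2| = c / 2 := abs_of_nonneg (by positivity)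
  -- A square of side `√|τ| / 2` has `4 · area = |τ|` and perimeter `2 √|τ|`; the sign of `τ` fixes
  -- the orientation.
  rcases abs_choice τ with hτ | hτ
  · have := ccDist_commutator_le p ⟨0, hn⟩ (-(c / 2)) (c / 2)
    rw [abs_neg, habs] at this
    convert this using 3 <;> linarith
  · have := ccDist_commutator_le p ⟨0, hn⟩ (c / 2) (c / 2)
    rw [habs] at this
    convert this using 3 <;> linarith

/-- The straight horizontal segment from `p` to the vertical line through `q` misses `q` exactly by
the height gap. -/
theorem ccDist_le_heightGap (hn : 1 ≤ n) (p q : Heis n) :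
    ccDist p q ≤ ENNReal.ofReal (Real.sqrt (∑ j, ((q.x j - p.x j) ^ 2 + (q.y j - p.y j) ^ 2)) +
      2 * Real.sqrt |heightGap p q|) := by
  set m : Heis n := ⟨p.x + (q.x - p.x), p.y + (q.y - p.y),
    p.t + 2 * ∑ j, (p.y j * (q.x - p.x) j - p.x j * (q.y - p.y) j)⟩ with hm
  have h₁ : ccDist p m ≤ _ := ccDist_segment_le p (q.x - p.x) (q.y - p.y)
  have h₂ := ccDist_vertical_le hn m (heightGap p q)
  have e : (⟨m.x, m.y, m.t + heightGap p q⟩ : Heis n) = q := by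
    refine Heis.ext ?_ ?_ ?_
    · simp [hm]
    · simp [hm]
    · simp [hm, heightGap]
  rw [e] at h₂
  rw [ENNReal.ofReal_add (by positivity) (by positivity)]
  exact (ccDist_triangle _ _ _).trans (add_le_add h₁ h₂)

theorem ccDist_ne_top (hn : 1 ≤ n) (p q : Heis n) : ccDist p q ≠ ⊤ :=
  ne_top_of_le_ne_top ENNReal.ofReal_ne_top (ccDist_le_heightGap hn p q)

theorem sqrt_sum_sq_le_sum_abs (a b : Fin n → ℝ) :
    Real.sqrt (∑ j, (a j ^ 2 + b j ^ 2)) ≤ ∑ j, (|a j| + |b j|) := by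
  have h0 : ∀ j ∈ Finset.univ, 0 ≤ |a j| + |b j| := fun j _ => by positivity
  refine Real.sqrt_le_iff.2 ⟨Finset.sum_nonneg h0, ?_⟩
  refine le_trans (Finset.sum_le_sum fun j _ => ?_) (Finset.sum_sq_le_sq_sum_of_nonneg h0)
  nlinarith [sq_abs (a j), sq_abs (b j), abs_nonneg (a j), abs_nonneg (b j)]

/-- Linear growth in the coordinates, from `2 √|t| ≤ 1 + |t|`, is what keeps Lipschitz functions of
an `L^p` map in `L^p` on a bounded set. -/
theorem ccDist_origin_le (hn : 1 ≤ n) (q : Heis n) :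
    ccDist ⟨0, 0, 0⟩ q ≤ ENNReal.ofReal (∑ j, (|q.x j| + |q.y j|) + (1 + |q.t|)) := by
  refine (ccDist_le_heightGap hn _ q).trans (ENNReal.ofReal_le_ofReal (add_le_add ?_ ?_))
  · simpa using sqrt_sum_sq_le_sum_abs q.x q.y
  · simp only [heightGap, Pi.zero_apply, zero_mul, sub_zero, Finset.sum_const_zero, mul_zero]
    nlinarith [Real.sq_sqrt (abs_nonneg q.t), sq_nonneg (Real.sqrt |q.t| - 1)]

/-- The Euclidean topology is at least as fine as the metric one; this supplies both measurability
of `φ ∘ F` and separability of `ℍ^n`. -/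
theorem continuous_mk (hn : 1 ≤ n) :
    Continuous fun z : (Fin n → ℝ) × (Fin n → ℝ) × ℝ => (⟨z.1, z.2.1, z.2.2⟩ : Heis n) := by
  rw [continuous_iff_continuousAt]
  intro z₀
  rw [ContinuousAt, tendsto_iff_edist_tendsto_0]
  set B : (Fin n → ℝ) × (Fin n → ℝ) × ℝ → ℝ := fun z =>
    Real.sqrt (∑ j, ((z₀.1 j - z.1 j) ^ 2 + (z₀.2.1 j - z.2.1 j) ^ 2)) +
      2 * Real.sqrt |z₀.2.2 - z.2.2 - 2 * ∑ j, (z.2.1 j * (z₀.1 j - z.1 j) -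
        z.1 j * (z₀.2.1 j - z.2.1 j))| with hB
  have hBc : Continuous B := by fun_prop
  have h0 : Tendsto (fun z => ENNReal.ofReal (B z)) (𝓝 z₀) (𝓝 0) := by
    have := (ENNReal.continuous_ofReal.comp hBc).tendsto z₀
    simpa [hB, Function.comp_def] using this
  exact tendsto_of_tendsto_of_tendsto_of_le_of_le tendsto_const_nhds h0 (fun _ => zero_le)
    fun z => ccDist_le_heightGap hn _ _

theorem separableSpace (hn : 1 ≤ n) : TopologicalSpace.SeparableSpace (Heis n) :=
  (Function.Surjective.denseRange (f := fun z : (Fin n → ℝ) × (Fin n → ℝ) × ℝ =>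
    (⟨z.1, z.2.1, z.2.2⟩ : Heis n)) fun p => ⟨(p.x, p.y, p.t), rfl⟩).separableSpace (continuous_mk hn)

/-! ### Lower bounds -/

theorem measurable_speed (γ : ℝ → Heis n) : Measurable (speed γ) := by
  refine (Finset.measurable_fun_sum _ fun j _ => ?_).sqrt
  exact ((measurable_deriv _).pow_const 2).add ((measurable_deriv _).pow_const 2)

theorem abs_deriv_x_le_speed (γ : ℝ → Heis n) (s : ℝ) (j : Fin n) :
    |deriv (fun r => (γ r).x j) s| ≤ speed γ s := by
  refine Real.abs_le_sqrt (le_trans ?_ (Finset.single_le_sum (f := fun j =>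
    deriv (fun r => (γ r).x j) s ^ 2 + deriv (fun r => (γ r).y j) s ^ 2)
    (fun i _ => by positivity) (Finset.mem_univ j)))
  exact le_add_of_nonneg_right (sq_nonneg _)

theorem abs_deriv_y_le_speed (γ : ℝ → Heis n) (s : ℝ) (j : Fin n) :
    |deriv (fun r => (γ r).y j) s| ≤ speed γ s := by
  refine Real.abs_le_sqrt (le_trans ?_ (Finset.single_le_sum (f := fun j =>
    deriv (fun r => (γ r).x j) s ^ 2 + deriv (fun r => (γ r).y j) s ^ 2)
    (fun i _ => by positivity) (Finset.mem_univ j)))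
  exact le_add_of_nonneg_left (sq_nonneg _)

theorem speed_nonneg (γ : ℝ → Heis n) (s : ℝ) : 0 ≤ speed γ s := Real.sqrt_nonneg _

theorem IsHorizontal.intervalIntegrable_speed {γ : ℝ → Heis n} {a b : ℝ}
    (h : IsHorizontal γ a b) : IntervalIntegrable (speed γ) volume a b := by
  have hi : IntervalIntegrable (fun s => ∑ j, (|deriv (fun r => (γ r).x j) s| +
      |deriv (fun r => (γ r).y j) s|)) volume a b := by
    have := IntervalIntegrable.sum (μ := volume) (a := a) (b := b) Finset.univ
      (f := fun (j : Fin n) s => |deriv (fun r => (γ r).x j) s| + |deriv (fun r => (γ r).y j) s|)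
      fun j _ => ((h.ac_x j).intervalIntegrable_deriv.abs.add (h.ac_y j).intervalIntegrable_deriv.abs)
    simpa only [Finset.sum_fn] using this
  refine hi.mono_fun (measurable_speed γ).aestronglyMeasurable (.of_forall fun s => ?_)
  refine (Real.norm_of_nonneg (speed_nonneg γ s)).le.trans ?_
  exact (sqrt_sum_sq_le_sum_abs _ _).trans (le_abs_self _)

theorem IsHorizontal.length_eq {γ : ℝ → Heis n} {a b : ℝ} (hab : a ≤ b)
    (h : IsHorizontal γ a b) : length γ a b = ENNReal.ofReal (∫ s in a..b, speed γ s) := by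
  rw [intervalIntegral.integral_of_le hab, ← integral_Icc_eq_integral_Ioc,
    ofReal_integral_eq_lintegral_ofReal _ (.of_forall fun s => speed_nonneg γ s)]
  · rfl
  · exact (intervalIntegrable_iff_integrableOn_Icc_of_le hab).1 h.intervalIntegrable_speed

theorem abs_sub_le_of_ac {f : ℝ → ℝ} {σ : ℝ → ℝ} {a b s : ℝ} (hs : s ∈ Icc a b)
    (hf : AbsolutelyContinuousOnInterval f a b) (hσ : IntervalIntegrable σ volume a b)
    (hfσ : ∀ r, |deriv f r| ≤ σ r) : |f s - f a| ≤ ∫ r in a..b, σ r := by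
  have hab := hs.1.trans hs.2
  have hs' : s ∈ uIcc a b := by rwa [uIcc_of_le hab]
  rw [ac_integral hf hs', add_sub_cancel_left]
  refine (intervalIntegral.norm_integral_le_of_norm_le (f := deriv f) hs.1 (.of_forall fun r _ => hfσ r)
    (hσ.mono_set (uIcc_subset_uIcc_left hs'))).trans ?_
  exact intervalIntegral.integral_mono_interval le_rfl hs.1 hs.2
    (.of_forall fun r => (abs_nonneg _).trans (hfσ r)) hσ

theorem IsHorizontal.abs_x_sub_le {γ : ℝ → Heis n} {a b s : ℝ} (h : IsHorizontal γ a b)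
    (hs : s ∈ Icc a b) (j : Fin n) : |(γ s).x j - (γ a).x j| ≤ ∫ r in a..b, speed γ r :=
  abs_sub_le_of_ac hs (h.ac_x j) h.intervalIntegrable_speed fun r => abs_deriv_x_le_speed γ r j

theorem IsHorizontal.abs_y_sub_le {γ : ℝ → Heis n} {a b s : ℝ} (h : IsHorizontal γ a b)
    (hs : s ∈ Icc a b) (j : Fin n) : |(γ s).y j - (γ a).y j| ≤ ∫ r in a..b, speed γ r :=
  abs_sub_le_of_ac hs (h.ac_y j) h.intervalIntegrable_speed fun r => abs_deriv_y_le_speed γ r j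

/-- Freezing the coefficients of the contact form at `γ a` leaves the integrand `2 ∑ ((y_j(s) -
y_j(a)) x_j' - (x_j(s) - x_j(a)) y_j')`. Each increment is at most the length and each derivative at
most the speed, so the bound is quadratic in the length. -/
theorem IsHorizontal.abs_heightGap_le {γ : ℝ → Heis n} {a b : ℝ} (hab : a ≤ b)
    (h : IsHorizontal γ a b) :
    |heightGap (γ a) (γ b)| ≤ 4 * n * (∫ r in a..b, speed γ r) ^ 2 := by
  set ℓ := ∫ r in a..b, speed γ r with hℓ
  have ix := fun j => (h.ac_x j).intervalIntegrable_deriv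
  have iy := fun j => (h.ac_y j).intervalIntegrable_deriv
  have isum : IntervalIntegrable (fun s => ∑ j, ((γ a).y j * deriv (fun r => (γ r).x j) s -
      (γ a).x j * deriv (fun r => (γ r).y j) s)) volume a b := by
    have := IntervalIntegrable.sum (μ := volume) (a := a) (b := b) Finset.univ
      (f := fun (j : Fin n) s => (γ a).y j * deriv (fun r => (γ r).x j) s -
      (γ a).x j * deriv (fun r => (γ r).y j) s)
      fun j _ => ((ix j).const_mul _).sub ((iy j).const_mul _)
    simpa only [Finset.sum_fn] using this
  have hgap : heightGap (γ a) (γ b) = ∫ s in a..b, (deriv (fun r => (γ r).t) s -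
      2 * ∑ j, ((γ a).y j * deriv (fun r => (γ r).x j) s -
        (γ a).x j * deriv (fun r => (γ r).y j) s)) := by
    rw [intervalIntegral.integral_sub h.ac_t.intervalIntegrable_deriv (isum.const_mul 2),
      intervalIntegral.integral_const_mul, intervalIntegral.integral_finsetSum
        (fun j _ => ((ix j).const_mul _).sub ((iy j).const_mul _)), heightGap,
      h.ac_t.integral_deriv_eq_sub]
    congr 2
    refine Finset.sum_congr rfl fun j _ => ?_
    rw [intervalIntegral.integral_sub ((ix j).const_mul _) ((iy j).const_mul _),
      intervalIntegral.integral_const_mul, intervalIntegral.integral_const_mul,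
      (h.ac_x j).integral_deriv_eq_sub, (h.ac_y j).integral_deriv_eq_sub]
  have hbound : ∀ᵐ s, s ∈ Ioc a b → ‖deriv (fun r => (γ r).t) s -
      2 * ∑ j, ((γ a).y j * deriv (fun r => (γ r).x j) s -
        (γ a).x j * deriv (fun r => (γ r).y j) s)‖ ≤ 4 * n * ℓ * speed γ s := by
    filter_upwards [(ae_restrict_iff' measurableSet_Icc).1 h.contact] with s hs hm
    have hsm := Ioc_subset_Icc_self hm
    rw [hs hsm, ← mul_sub, ← Finset.sum_sub_distrib, norm_mul, Real.norm_ofNat]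
    have : ‖∑ j, ((γ s).y j * deriv (fun r => (γ r).x j) s - (γ s).x j * deriv (fun r => (γ r).y j) s -
        ((γ a).y j * deriv (fun r => (γ r).x j) s - (γ a).x j * deriv (fun r => (γ r).y j) s))‖ ≤
        ∑ _j : Fin n, 2 * ℓ * speed γ s := by
      refine norm_sum_le_of_le _ fun j _ => ?_
      have e : (γ s).y j * deriv (fun r => (γ r).x j) s - (γ s).x j * deriv (fun r => (γ r).y j) s -
        ((γ a).y j * deriv (fun r => (γ r).x j) s - (γ a).x j * deriv (fun r => (γ r).y j) s) =
        ((γ s).y j - (γ a).y j) * deriv (fun r => (γ r).x j) s -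
        ((γ s).x j - (γ a).x j) * deriv (fun r => (γ r).y j) s := by ring
      have h1 := mul_le_mul (h.abs_y_sub_le hsm j) (abs_deriv_x_le_speed γ s j) (abs_nonneg _)
        ((abs_nonneg _).trans (h.abs_y_sub_le hsm j))
      have h2 := mul_le_mul (h.abs_x_sub_le hsm j) (abs_deriv_y_le_speed γ s j) (abs_nonneg _)
        ((abs_nonneg _).trans (h.abs_x_sub_le hsm j))
      rw [← abs_mul] at h1 h2
      rw [e]
      refine (norm_sub_le _ _).trans ?_
      rw [Real.norm_eq_abs, Real.norm_eq_abs]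
      linarith
    rw [Finset.sum_const, Finset.card_univ, Fintype.card_fin, nsmul_eq_mul] at this
    linarith
  rw [hgap]
  refine (intervalIntegral.norm_integral_le_of_norm_le hab hbound
    (h.intervalIntegrable_speed.const_mul _)).trans (le_of_eq ?_)
  rw [intervalIntegral.integral_const_mul]
  ring

theorem ofReal_le_ccDist {p q : Heis n} {c : ℝ}
    (h : ∀ (γ : ℝ → Heis n) (a b : ℝ), a ≤ b → IsHorizontal γ a b → γ a = p → γ b = q →
      c ≤ ∫ s in a..b, speed γ s) : ENNReal.ofReal c ≤ ccDist p q := by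
  refine le_iInf fun γ => le_iInf fun a => le_iInf fun b => le_iInf fun ⟨hab, hγ, ha, hb⟩ => ?_
  rw [hγ.length_eq hab]
  exact ENNReal.ofReal_le_ofReal (h γ a b hab hγ ha hb)

theorem ofReal_abs_x_sub_le (p q : Heis n) (j : Fin n) :
    ENNReal.ofReal |q.x j - p.x j| ≤ ccDist p q :=
  ofReal_le_ccDist fun γ a b hab h ha hb => by
    simpa only [ha, hb] using h.abs_x_sub_le (right_mem_Icc.2 hab) j

theorem ofReal_abs_y_sub_le (p q : Heis n) (j : Fin n) :
    ENNReal.ofReal |q.y j - p.y j| ≤ ccDist p q :=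
  ofReal_le_ccDist fun γ a b hab h ha hb => by
    simpa only [ha, hb] using h.abs_y_sub_le (right_mem_Icc.2 hab) j

theorem ofReal_sqrt_heightGap_le (p q : Heis n) :
    ENNReal.ofReal (Real.sqrt (|heightGap p q| / (4 * n))) ≤ ccDist p q :=
  ofReal_le_ccDist fun γ a b hab h ha hb => by
    have h1 := h.abs_heightGap_le hab
    rw [ha, hb] at h1
    have h0 : 0 ≤ ∫ s in a..b, speed γ s :=
      intervalIntegral.integral_nonneg hab fun s _ => speed_nonneg γ s
    refine Real.sqrt_le_iff.2 ⟨h0, ?_⟩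
    -- For `n = 0` the quotient is `0` by convention, so no positivity of `n` is needed.
    refine div_le_of_le_mul₀ (by positivity) (sq_nonneg _) ?_
    linarith

end Heis

/-! ### Primitives at almost every parameter of a segment -/

section Segments

variable {E : Type*} [NormedAddCommGroup E] [NormedSpace ℝ E]
  [MeasurableSpace E] [BorelSpace E] [FiniteDimensional ℝ E] {μ : Measure E} [μ.IsAddHaarMeasure]

theorem measurable_integral_add_smul {v : E → ℝ} (hv : Measurable v) (e : E) :
    Measurable fun z : E × ℝ => ∫ r in Ioc 0 z.2, v (z.1 + r • e) := by
  have h1 : MeasurableSet {w : (E × ℝ) × ℝ | w.2 ∈ Ioc 0 w.1.2} :=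
    (measurableSet_lt measurable_const measurable_snd).inter
      (measurableSet_le measurable_snd (measurable_snd.comp measurable_fst))
  have h2 : Measurable fun w : (E × ℝ) × ℝ => v (w.1.1 + w.2 • e) := hv.comp (by fun_prop)
  have h3 := (h2.indicator h1).stronglyMeasurable.integral_prod_right' (ν := volume)
  convert h3.measurable using 2 with z
  rw [← integral_indicator measurableSet_Ioc]
  rfl

/-- A function with weak derivative `v` in direction `e` agrees almost everywhere with a primitive
of `v` on almost every segment with direction `e`. -/
theorem ae_ae_sub_eq_integral_of_weak {Ω : Set E} (hΩ : IsOpen Ω) {e : E} {u v : E → ℝ}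
    (hu : Integrable u μ) (hv : Integrable v μ)
    (hw : ∀ φ : E → ℝ, ContDiff ℝ ∞ φ → HasCompactSupport φ → tsupport φ ⊆ Ω →
      ∫ x, u x * fderiv ℝ φ x e ∂μ = -∫ x, v x * φ x ∂μ) (δ : ℝ) :
    ∀ᵐ x ∂μ, x ∈ segmentBase Ω e δ → ∀ᵐ r : ℝ, r ∈ Icc 0 δ →
      u (x + r • e) - u x = ∫ s in (0 : ℝ)..r, v (x + s • e) := by
  obtain ⟨u', hu'm, huu'⟩ := hu.1
  obtain ⟨v', hv'm, hvv'⟩ := hv.1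
  -- For each fixed `r` the identity holds for almost every `x`; the order of the quantifiers is
  -- then exchanged. Measurable representatives and an integral over `Ioc` make the set of pairs
  -- measurable for that exchange.
  have h1 : ∀ᵐ r : ℝ, ∀ᵐ x ∂μ, r ∈ Icc 0 δ → x ∈ segmentBase Ω e δ →
      u' (x + r • e) - u' x = ∫ s in Ioc 0 r, v' (x + s • e) := by
    refine .of_forall fun r => ?_
    by_cases hr : r ∈ Icc 0 δ
    · filter_upwards [ae_sub_eq_integral_of_weak hΩ hu hv hw hr.1, huu', ae_add_smul huu' e r,
        ae_ae_add_smul hvv' e] with x hx h2 h3 h4 _ hm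
      rw [← h2, ← h3, hx (segmentBase_subset hr.2 hm), intervalIntegral.integral_of_le hr.1]
      exact setIntegral_congr_ae measurableSet_Ioc (by filter_upwards [h4] with s hs _ using hs)
    · exact .of_forall fun x h => absurd h hr
  rw [← Measure.ae_ae_comm (p := fun x r => r ∈ Icc 0 δ → x ∈ segmentBase Ω e δ →
      u' (x + r • e) - u' x = ∫ s in Ioc 0 r, v' (x + s • e))] at h1
  · filter_upwards [h1, huu', ae_ae_add_smul huu' e, ae_ae_add_smul hvv' e] with x hx h2 h3 h4 hm
    filter_upwards [hx, h3] with r hr h5 hrm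
    rw [h2, h5, hr hrm hm, intervalIntegral.integral_of_le hrm.1]
    exact setIntegral_congr_ae measurableSet_Ioc (by filter_upwards [h4] with s hs _ using hs.symm)
  · have m1 : MeasurableSet {z : E × ℝ | z.1 ∈ segmentBase Ω e δ} :=
      measurable_fst (isOpen_segmentBase hΩ e _).measurableSet
    have m2 : MeasurableSet {z : E × ℝ | z.2 ∈ Icc (0 : ℝ) δ} := measurable_snd measurableSet_Icc
    refine m2.imp (m1.imp (measurableSet_eq_fun ?_ (measurable_integral_add_smul hv'm.measurable e)))
    exact (hu'm.measurable.comp (measurable_add_smul e)).sub (hu'm.measurable.comp measurable_fst)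

end Segments

/-! ### Passing between weak partials on an open set and functions on the whole space -/

section WeakPartial

variable {m : ℕ} {Ω : Set (EuclideanSpace ℝ (Fin m))} {k : Fin m}
  {u v w : EuclideanSpace ℝ (Fin m) → ℝ}

/-- Extension by zero is harmless because only test functions supported in `Ω` are used; it gives
access to the results for functions integrable on the whole space. -/
theorem IsWeakPartial.integral_indicator (h : IsWeakPartial Ω k u v) (hΩ : MeasurableSet Ω)
    (φ : EuclideanSpace ℝ (Fin m) → ℝ) (hφ : ContDiff ℝ ∞ φ) (hc : HasCompactSupport φ)
    (hs : tsupport φ ⊆ Ω) :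
    ∫ x, Ω.indicator u x * fderiv ℝ φ x (EuclideanSpace.single k 1) =
      -∫ x, Ω.indicator v x * φ x := by
  have := h.2.2 φ hφ hc hs
  rw [← MeasureTheory.integral_indicator hΩ, ← MeasureTheory.integral_indicator hΩ] at this
  simpa only [indicator_mul_left] using this

theorem isWeakPartial_of_integral_indicator (hΩ : MeasurableSet Ω) (hu : IntegrableOn u Ω)
    (hv : Integrable v)
    (h : ∀ φ : EuclideanSpace ℝ (Fin m) → ℝ, ContDiff ℝ ∞ φ → HasCompactSupport φ →
      tsupport φ ⊆ Ω → ∫ x, Ω.indicator u x * fderiv ℝ φ x (EuclideanSpace.single k 1) =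
        -∫ x, v x * φ x) : IsWeakPartial Ω k u v := by
  refine ⟨hu.locallyIntegrableOn, hv.integrableOn.locallyIntegrableOn, fun φ hφ hc hs => ?_⟩
  have := h φ hφ hc hs
  have hi : ∫ x, Ω.indicator u x * fderiv ℝ φ x (EuclideanSpace.single k 1) =
      ∫ x in Ω, u x * fderiv ℝ φ x (EuclideanSpace.single k 1) := by
    rw [← MeasureTheory.integral_indicator hΩ]
    simp only [indicator_mul_left]
  rw [← hi, this, setIntegral_eq_integral_of_forall_compl_eq_zero]
  intro x hx
  rw [image_eq_zero_of_notMem_tsupport fun hm => hx (hs hm), mul_zero]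

theorem IsWeakPartial.congr {u' : EuclideanSpace ℝ (Fin m) → ℝ} (h : IsWeakPartial Ω k u v)
    (hΩ : MeasurableSet Ω) (hu : ∀ x ∈ Ω, u' x = u x) : IsWeakPartial Ω k u' v := by
  have hae : u =ᵐ[volume.restrict Ω] u' :=
    (ae_restrict_iff' hΩ).2 (.of_forall fun x hx => (hu x hx).symm)
  refine ⟨fun x hx => ?_, h.2.1, fun φ hφ hc hs => ?_⟩
  · obtain ⟨s, hs, hi⟩ := h.1 x hx
    exact ⟨s ∩ Ω, Filter.inter_mem hs self_mem_nhdsWithin, (hi.mono_set inter_subset_left).congr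
      (ae_mono (Measure.restrict_mono inter_subset_right le_rfl) hae)⟩
  · rw [← h.2.2 φ hφ hc hs]
    exact setIntegral_congr_fun hΩ fun x hx => by simp only [hu x hx]

theorem SobolevReal.congr {p : ℝ≥0∞} {u' : EuclideanSpace ℝ (Fin m) → ℝ}
    (h : u ∈ SobolevReal p Ω) (hΩ : MeasurableSet Ω) (hu : ∀ x ∈ Ω, u' x = u x) :
    u' ∈ SobolevReal p Ω := by
  have hae : u =ᵐ[volume.restrict Ω] u' :=
    (ae_restrict_iff' hΩ).2 (.of_forall fun x hx => (hu x hx).symm)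
  refine ⟨h.1.ae_eq hae, fun k => ?_⟩
  obtain ⟨v, hv, hw⟩ := h.2 k
  exact ⟨v, hv, hw.congr hΩ hu⟩

theorem IsWeakPartial.ae_eq (hΩ : IsOpen Ω) (hv : IsWeakPartial Ω k u v)
    (hw : IsWeakPartial Ω k u w) : v =ᵐ[volume.restrict Ω] w := by
  have := hΩ.ae_eq_zero_of_integral_contDiff_smul_eq_zero (f := fun x => v x - w x)
    (hv.2.1.sub hw.2.1) ?_
  · refine (ae_restrict_iff' hΩ.measurableSet).2 ?_
    filter_upwards [this] with x hx hm using sub_eq_zero.1 (hx hm)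
  intro φ hφ hc hs
  have hint : ∀ {z}, LocallyIntegrableOn z Ω volume → IntegrableOn (fun x => z x * φ x) Ω := by
    intro z hz
    have h1 : IntegrableOn (fun x => z x * φ x) (tsupport φ) :=
      (hz.integrableOn_compact_subset hs hc).mul_continuousOn hφ.continuous.continuousOn hc
    have h2 : Integrable (fun x => z x * φ x) :=
      (integrableOn_iff_integrable_of_support_subset fun x hx =>
        subset_tsupport φ (right_ne_zero_of_mul (Function.mem_support.1 hx))).1 h1
    exact h2.integrableOn
  rw [← setIntegral_eq_integral_of_forall_compl_eq_zero (s := Ω) fun x hx => by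
    rw [image_eq_zero_of_notMem_tsupport fun hm => hx (hs hm), zero_smul]]
  simp only [smul_eq_mul, mul_comm (φ _), sub_mul]
  rw [integral_sub (hint hv.2.1) (hint hw.2.1), ← neg_inj, neg_sub, sub_eq_neg_add,
    ← hv.2.2 φ hφ hc hs, ← neg_neg (∫ x in Ω, w x * φ x), ← hw.2.2 φ hφ hc hs]
  simp

/-- The partials provided by `WeakContact` carry no `L^p` bound; uniqueness of weak partials gives
them one. -/
theorem SobolevReal.memLp {p : ℝ≥0∞} (hu : u ∈ SobolevReal p Ω) (hΩ : IsOpen Ω)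
    (hv : IsWeakPartial Ω k u v) : MemLp v p (volume.restrict Ω) := by
  obtain ⟨w, hw, hw'⟩ := hu.2 k
  exact hw.ae_eq (hw'.ae_eq hΩ hv)

theorem ae_intervalIntegrable_of_integrableOn (hΩ : IsOpen Ω) (hv : IntegrableOn v Ω)
    (e : EuclideanSpace ℝ (Fin m)) {δ : ℝ} (hδ : 0 ≤ δ) :
    ∀ᵐ x, x ∈ segmentBase Ω e δ →
      IntervalIntegrable (fun r => v (x + r • e)) volume 0 δ := by
  filter_upwards [ae_intervalIntegrable_add_smul (hv.integrable_indicator hΩ.measurableSet)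
    e] with x hx hm
  refine (hx 0 δ).congr fun r hr => ?_
  rw [uIoc_of_le hδ] at hr
  exact indicator_of_mem (hm r (Ioc_subset_Icc_self hr)) v

theorem IsWeakPartial.ae_sub_eq_integral (h : IsWeakPartial Ω k u v) (hΩ : IsOpen Ω)
    (hu : IntegrableOn u Ω) (hv : IntegrableOn v Ω) {s : ℝ} (hs : 0 ≤ s) :
    ∀ᵐ x, x ∈ segmentBase Ω (EuclideanSpace.single k 1) s →
      u (x + s • EuclideanSpace.single k 1) - u x =
        ∫ r in (0 : ℝ)..s, v (x + r • EuclideanSpace.single k 1) := by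
  have hm := hΩ.measurableSet
  filter_upwards [ae_sub_eq_integral_of_weak hΩ (hu.integrable_indicator hm)
    (hv.integrable_indicator hm) (h.integral_indicator hm) hs] with x hx hxs
  have h0 := hxs 0 ⟨le_rfl, hs⟩
  rw [zero_smul, add_zero] at h0
  have := hx hxs
  rw [indicator_of_mem (hxs s ⟨hs, le_rfl⟩), indicator_of_mem h0] at this
  rw [this]
  refine intervalIntegral.integral_congr fun r hr => ?_
  rw [uIcc_of_le hs] at hr
  exact indicator_of_mem (hxs r hr) v

theorem IsWeakPartial.ae_ae_sub_eq_integral (h : IsWeakPartial Ω k u v) (hΩ : IsOpen Ω)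
    (hu : IntegrableOn u Ω) (hv : IntegrableOn v Ω) (δ : ℝ) :
    ∀ᵐ x, x ∈ segmentBase Ω (EuclideanSpace.single k 1) δ → ∀ᵐ r : ℝ, r ∈ Icc 0 δ →
      u (x + r • EuclideanSpace.single k 1) - u x =
        ∫ s in (0 : ℝ)..r, v (x + s • EuclideanSpace.single k 1) := by
  have hm := hΩ.measurableSet
  filter_upwards [ae_ae_sub_eq_integral_of_weak hΩ (hu.integrable_indicator hm)
    (hv.integrable_indicator hm) (h.integral_indicator hm) δ] with x hx hxs
  filter_upwards [hx hxs] with r hr hrm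
  have h0 := hxs 0 ⟨le_rfl, hrm.1.trans hrm.2⟩
  rw [zero_smul, add_zero] at h0
  have := hr hrm
  rw [indicator_of_mem (hxs r hrm), indicator_of_mem h0] at this
  rw [this]
  refine intervalIntegral.integral_congr fun s hs => ?_
  rw [uIcc_of_le hrm.1] at hs
  exact indicator_of_mem (hxs s ⟨hs.1, hs.2.trans hrm.2⟩) v

end WeakPartial

/-! ### Weakly contact Sobolev maps are Ambrosio-Reshetnyak-Sobolev maps -/

namespace Heis

open Filter Topology

variable {n : ℕ}

theorem _root_.LipschitzWith.abs_sub_le_of_ccDist_le {K : ℝ≥0} {φ : Heis n → ℝ}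
    (hφ : LipschitzWith K φ) {p q : Heis n} {c : ℝ} (hc : ccDist p q ≤ ENNReal.ofReal c) (h0 : 0 ≤ c) :
    |φ q - φ p| ≤ K * c := by
  have h1 : edist (φ p) (φ q) ≤ ENNReal.ofReal (K * c) := by
    refine (hφ p q).trans ?_
    rw [ENNReal.ofReal_mul K.coe_nonneg, ENNReal.ofReal_coe_nnreal]
    exact mul_le_mul_right hc _
  rw [edist_dist, ENNReal.ofReal_le_ofReal_iff (by positivity), dist_comm, Real.dist_eq] at h1
  exact h1

/-- The curve in `ℍ^n` that starts at `p` and whose coordinates have derivatives `α`, `β`, `τ`. -/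
noncomputable def primitiveCurve (p : Heis n) (α β : Fin n → ℝ → ℝ) (τ : ℝ → ℝ) : ℝ → Heis n :=
  fun r => ⟨fun j => p.x j + ∫ s in (0 : ℝ)..r, α j s, fun j => p.y j + ∫ s in (0 : ℝ)..r, β j s,
    p.t + ∫ s in (0 : ℝ)..r, τ s⟩

theorem ac_primitive {w : ℝ → ℝ} {δ : ℝ} (c : ℝ) (hw : IntervalIntegrable w volume 0 δ) :
    AbsolutelyContinuousOnInterval (fun r => c + ∫ s in (0 : ℝ)..r, w s) 0 δ :=
  ac_of_integral hw fun s _ => by simp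

theorem ae_deriv_primitive {w : ℝ → ℝ} {δ : ℝ} (c : ℝ) (hδ : 0 ≤ δ)
    (hw : IntervalIntegrable w volume 0 δ) :
    ∀ᵐ r : ℝ, r ∈ Icc 0 δ → deriv (fun r => c + ∫ s in (0 : ℝ)..r, w s) r = w r := by
  filter_upwards [hw.ae_hasDerivAt_integral] with r hr hm
  rw [← uIcc_of_le hδ] at hm
  exact ((hr hm 0 left_mem_uIcc).const_add c).deriv

section

variable {p : Heis n} {α β : Fin n → ℝ → ℝ} {τ : ℝ → ℝ} {δ : ℝ}

theorem isHorizontal_primitiveCurve (hδ : 0 ≤ δ)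
    (hα : ∀ j, IntervalIntegrable (α j) volume 0 δ) (hβ : ∀ j, IntervalIntegrable (β j) volume 0 δ)
    (hτ : IntervalIntegrable τ volume 0 δ)
    (hc : ∀ᵐ r : ℝ, r ∈ Icc 0 δ → τ r = 2 * ∑ j, ((primitiveCurve p α β τ r).y j * α j r -
      (primitiveCurve p α β τ r).x j * β j r)) {a b : ℝ} (ha : 0 ≤ a) (hab : a ≤ b) (hb : b ≤ δ) :
    IsHorizontal (primitiveCurve p α β τ) a b := by
  have hsub : uIcc a b ⊆ uIcc 0 δ := by
    rw [uIcc_of_le hab, uIcc_of_le hδ]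
    exact Icc_subset_Icc ha hb
  refine ⟨fun j => (ac_primitive _ (hα j)).mono hsub, fun j => (ac_primitive _ (hβ j)).mono hsub,
    (ac_primitive _ hτ).mono hsub, (ae_restrict_iff' measurableSet_Icc).2 ?_⟩
  filter_upwards [hc, ae_all_iff.2 fun j => ae_deriv_primitive (p.x j) hδ (hα j),
    ae_all_iff.2 fun j => ae_deriv_primitive (p.y j) hδ (hβ j), ae_deriv_primitive p.t hδ hτ]
    with r h1 h2 h3 h4 hr
  have hr' : r ∈ Icc 0 δ := ⟨ha.trans hr.1, hr.2.trans hb⟩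
  have e1 : deriv (fun r => (primitiveCurve p α β τ r).t) r = τ r := h4 hr'
  rw [e1, h1 hr']
  congr 1
  refine Finset.sum_congr rfl fun j _ => ?_
  have e2 : deriv (fun r => (primitiveCurve p α β τ r).x j) r = α j r := h2 j hr'
  have e3 : deriv (fun r => (primitiveCurve p α β τ r).y j) r = β j r := h3 j hr'
  rw [e2, e3]

theorem ae_speed_primitiveCurve_le (hδ : 0 ≤ δ)
    (hα : ∀ j, IntervalIntegrable (α j) volume 0 δ)
    (hβ : ∀ j, IntervalIntegrable (β j) volume 0 δ) :
    ∀ᵐ r : ℝ, r ∈ Icc 0 δ →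
      speed (primitiveCurve p α β τ) r ≤ ∑ j, (|α j r| + |β j r|) := by
  filter_upwards [ae_all_iff.2 fun j => ae_deriv_primitive (p.x j) hδ (hα j),
    ae_all_iff.2 fun j => ae_deriv_primitive (p.y j) hδ (hβ j)] with r h2 h3 hr
  refine (sqrt_sum_sq_le_sum_abs _ _).trans (le_of_eq (Finset.sum_congr rfl fun j _ => ?_))
  have e2 : deriv (fun r => (primitiveCurve p α β τ r).x j) r = α j r := h2 j hr
  have e3 : deriv (fun r => (primitiveCurve p α β τ r).y j) r = β j r := h3 j hr
  rw [e2, e3]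

end

variable {m : ℕ} {Ω : Set (EuclideanSpace ℝ (Fin m))} {F : EuclideanSpace ℝ (Fin m) → Heis n}

theorem memLp_comp_of_lipschitzWith (hn : 1 ≤ n) {X : Type*} [MeasurableSpace X] {μ : Measure X}
    [IsFiniteMeasure μ] {p : ℝ≥0∞} {F : X → Heis n} (hx : ∀ j, MemLp (fun x => (F x).x j) p μ)
    (hy : ∀ j, MemLp (fun x => (F x).y j) p μ) (ht : MemLp (fun x => (F x).t) p μ)
    {K : ℝ≥0} {φ : Heis n → ℝ} (hφ : LipschitzWith K φ) : MemLp (fun x => φ (F x)) p μ := by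
  have hcoord : AEMeasurable
      (fun x => ((F x).x, (F x).y, (F x).t) : X → (Fin n → ℝ) × (Fin n → ℝ) × ℝ) μ :=
    (aemeasurable_pi_lambda _ fun j => (hx j).1.aemeasurable).prodMk
      ((aemeasurable_pi_lambda _ fun j => (hy j).1.aemeasurable).prodMk ht.1.aemeasurable)
  have hc : Continuous fun z : (Fin n → ℝ) × (Fin n → ℝ) × ℝ => φ ⟨z.1, z.2.1, z.2.2⟩ :=
    hφ.continuous.comp (continuous_mk hn)
  have hm : AEStronglyMeasurable (fun x => φ (F x)) μ :=
    (hc.measurable.comp_aemeasurable hcoord).aestronglyMeasurable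
  have hs : MemLp (fun x => ∑ j, (|(F x).x j| + |(F x).y j|)) p μ :=
    memLp_finsetSum _ fun j _ => (hx j).abs.add (hy j).abs
  have h1 : MemLp (fun _ : X => (1 : ℝ)) p μ := memLp_const 1
  have h0 : MemLp (fun _ : X => |φ ⟨0, 0, 0⟩|) p μ := memLp_const |φ ⟨0, 0, 0⟩|
  have hb : MemLp (fun x => |φ ⟨0, 0, 0⟩| +
      K * (∑ j, (|(F x).x j| + |(F x).y j|) + (1 + |(F x).t|))) p μ :=
    h0.add ((hs.add (h1.add ht.abs)).const_mul (K : ℝ))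
  refine hb.mono' hm (.of_forall fun x => ?_)
  have h1 := hφ.abs_sub_le_of_ccDist_le (ccDist_origin_le hn (F x))
    (add_nonneg (Finset.sum_nonneg fun j _ => by positivity) (by positivity))
  have h2 := abs_sub_abs_le_abs_sub (φ (F x)) (φ ⟨0, 0, 0⟩)
  rw [Real.norm_eq_abs]
  linarith

/-- On almost every segment the primitive curve through `F x` is horizontal by the contact equation
and has length at most `∫ g`, so `φ` along that curve is the function `U` demanded by
`exists_weak_of_segments`. -/
theorem exists_isWeakPartial_comp (hΩ : IsOpen Ω) {k : Fin m}
    {α β : Fin n → EuclideanSpace ℝ (Fin m) → ℝ} {τ g : EuclideanSpace ℝ (Fin m) → ℝ}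
    (hFx : ∀ j, IntegrableOn (fun x => (F x).x j) Ω)
    (hFy : ∀ j, IntegrableOn (fun x => (F x).y j) Ω) (hFt : IntegrableOn (fun x => (F x).t) Ω)
    (hα : ∀ j, IntegrableOn (α j) Ω) (hβ : ∀ j, IntegrableOn (β j) Ω) (hτ : IntegrableOn τ Ω)
    (hwx : ∀ j, IsWeakPartial Ω k (fun x => (F x).x j) (α j))
    (hwy : ∀ j, IsWeakPartial Ω k (fun x => (F x).y j) (β j))
    (hwt : IsWeakPartial Ω k (fun x => (F x).t) τ)
    (hcontact : ∀ᵐ x ∂(volume.restrict Ω), τ x = 2 * ∑ j, ((F x).y j * α j x - (F x).x j * β j x))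
    (hg : IntegrableOn g Ω) (hαβg : ∀ x ∈ Ω, ∑ j, (|α j x| + |β j x|) ≤ g x)
    {K : ℝ≥0} {φ : Heis n → ℝ} (hφ : LipschitzWith K φ) (hφF : IntegrableOn (fun x => φ (F x)) Ω) :
    ∃ v, AEStronglyMeasurable v (volume.restrict Ω) ∧ IsWeakPartial Ω k (fun x => φ (F x)) v ∧
      ∀ᵐ x ∂(volume.restrict Ω), |v x| ≤ K * g x := by
  have hm := hΩ.measurableSet
  set e : EuclideanSpace ℝ (Fin m) := EuclideanSpace.single k 1 with he
  have hgK : IntegrableOn (fun x => K * g x) Ω := hg.const_mul (K : ℝ)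
  refine (exists_weak_of_segments hΩ (e := e) (hφF.integrable_indicator hm)
    (hgK.integrable_indicator hm) ?_).elim fun v hv => ?_
  rotate_left
  · obtain ⟨hvi, hvg, hvw⟩ := hv
    refine ⟨v, hvi.integrableOn.1, isWeakPartial_of_integral_indicator hm hφF hvi hvw, ?_⟩
    refine (ae_restrict_iff' hm).2 ?_
    filter_upwards [hvg] with x hx hxΩ
    simpa only [indicator_of_mem hxΩ] using hx hxΩ
  intro δ hδ
  have hcontact' := (ae_restrict_iff' hm).1 hcontact
  filter_upwards [ae_all_iff.2 fun j => ae_intervalIntegrable_of_integrableOn hΩ (hα j) e hδ.le,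
    ae_all_iff.2 fun j => ae_intervalIntegrable_of_integrableOn hΩ (hβ j) e hδ.le,
    ae_intervalIntegrable_of_integrableOn hΩ hτ e hδ.le,
    ae_intervalIntegrable_of_integrableOn hΩ hg e hδ.le,
    -- Both forms of the fundamental theorem are needed: the exact one at the endpoint `δ`, and the
    -- one at almost every parameter inside the segment.
    ae_all_iff.2 fun j => (hwx j).ae_sub_eq_integral hΩ (hFx j) (hα j) hδ.le,
    ae_all_iff.2 fun j => (hwy j).ae_sub_eq_integral hΩ (hFy j) (hβ j) hδ.le,
    hwt.ae_sub_eq_integral hΩ hFt hτ hδ.le,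
    ae_all_iff.2 fun j => (hwx j).ae_ae_sub_eq_integral hΩ (hFx j) (hα j) δ,
    ae_all_iff.2 fun j => (hwy j).ae_ae_sub_eq_integral hΩ (hFy j) (hβ j) δ,
    hwt.ae_ae_sub_eq_integral hΩ hFt hτ δ, ae_ae_add_smul hcontact' e]
    with x iα iβ iτ ig eα eβ eτ lα lβ lτ lc hx
  have hx0 : x ∈ Ω := by simpa using hx 0 ⟨le_rfl, hδ.le⟩
  set γ := primitiveCurve (F x) (fun j r => α j (x + r • e)) (fun j r => β j (x + r • e))
    (fun r => τ (x + r • e)) with hγ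
  have hγF : ∀ᵐ r : ℝ, r ∈ Icc 0 δ → γ r = F (x + r • e) := by
    filter_upwards [ae_all_iff.2 fun j => lα j hx, ae_all_iff.2 fun j => lβ j hx, lτ hx]
      with r h1 h2 h3 hr
    refine Heis.ext (funext fun j => ?_) (funext fun j => ?_) ?_
    · simp only [hγ, primitiveCurve, he, ← h1 j hr, add_sub_cancel]
    · simp only [hγ, primitiveCurve, he, ← h2 j hr, add_sub_cancel]
    · simp only [hγ, primitiveCurve, he, ← h3 hr, add_sub_cancel]
  -- The coefficients of the contact equation may be read off `γ` instead of `F`, as the two agree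
  -- almost everywhere on the segment.
  have hcγ : ∀ᵐ r : ℝ, r ∈ Icc 0 δ → τ (x + r • e) = 2 * ∑ j, ((γ r).y j * α j (x + r • e) -
      (γ r).x j * β j (x + r • e)) := by
    filter_upwards [hγF, lc] with r h1 h2 hr
    rw [h1 hr]
    exact h2 (hx r hr)
  refine ⟨fun r => φ (γ r), ?_, ?_, ?_, fun a b ha hab hb => ?_⟩
  · rw [indicator_of_mem hx0]
    simp only [hγ, primitiveCurve, intervalIntegral.integral_same, add_zero]
  · rw [indicator_of_mem (hx δ ⟨hδ.le, le_rfl⟩)]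
    refine congrArg φ (Heis.ext (funext fun j => ?_) (funext fun j => ?_) ?_)
    · simp only [hγ, primitiveCurve, he, ← eα j hx, add_sub_cancel]
    · simp only [hγ, primitiveCurve, he, ← eβ j hx, add_sub_cancel]
    · simp only [hγ, primitiveCurve, he, ← eτ hx, add_sub_cancel]
  · filter_upwards [hγF] with r hr hrδ
    have hr' := Ioo_subset_Icc_self hrδ
    rw [indicator_of_mem (hx r hr'), hr hr']
  · have hh : IsHorizontal γ a b := isHorizontal_primitiveCurve hδ.le (fun j => iα j hx)
      (fun j => iβ j hx) (iτ hx) hcγ ha hab hb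
    have hsp : ∫ r in a..b, speed γ r ≤ ∫ r in a..b, g (x + r • e) := by
      refine intervalIntegral.integral_mono_ae_restrict hab hh.intervalIntegrable_speed
        ((ig hx).mono_set ?_) ((ae_restrict_iff' measurableSet_Icc).2 ?_)
      · rw [uIcc_of_le hab, uIcc_of_le hδ.le]
        exact Icc_subset_Icc ha hb
      · filter_upwards [ae_speed_primitiveCurve_le (p := F x) (τ := fun r => τ (x + r • e)) hδ.le
          (fun j => iα j hx) (fun j => iβ j hx)] with r hr hrm
        have hr' : r ∈ Icc 0 δ := ⟨ha.trans hrm.1, hrm.2.trans hb⟩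
        exact (hr hr').trans (hαβg _ (hx r hr'))
    have hd := ccDist_le hab hh
    rw [hh.length_eq hab] at hd
    refine (hφ.abs_sub_le_of_ccDist_le hd
      (intervalIntegral.integral_nonneg hab fun s _ => speed_nonneg γ s)).trans ?_
    refine (mul_le_mul_of_nonneg_left hsp K.2).trans (le_of_eq ?_)
    rw [NNReal.val_eq_coe, ← intervalIntegral.integral_const_mul]
    refine intervalIntegral.integral_congr fun r hr => ?_
    rw [uIcc_of_le hab] at hr
    rw [indicator_of_mem (hx r ⟨ha.trans hr.1, hr.2.trans hb⟩)]

theorem sobolevHeis_subset_arSobolev (hn : 1 ≤ n) (hΩ : IsOpen Ω)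
    (hb : Bornology.IsBounded Ω) {p : ℝ≥0∞} (hp : 1 ≤ p) :
    SobolevHeis n p Ω ⊆ (ARSobolev p Ω : Set (EuclideanSpace ℝ (Fin m) → Heis n)) := by
  rintro F ⟨hx, hy, ht, hcontact⟩
  have : IsFiniteMeasure (volume.restrict Ω) := ⟨by simpa using hb.measure_lt_top⟩
  choose α β τ hwx hwy hwt hc using hcontact
  have hα := fun k j => SobolevReal.memLp (hx j) hΩ (hwx k j)
  have hβ := fun k j => SobolevReal.memLp (hy j) hΩ (hwy k j)
  have hτ := fun k => SobolevReal.memLp ht hΩ (hwt k)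
  have hg : MemLp (fun x => ∑ k, ∑ j, (|α k j x| + |β k j x|)) p (volume.restrict Ω) :=
    memLp_finsetSum _ fun k _ => memLp_finsetSum _ fun j _ => (hα k j).abs.add (hβ k j).abs
  refine ⟨fun x => ∑ k, ∑ j, (|α k j x| + |β k j x|), fun x _ => by positivity, hg,
    fun K φ hφ => ?_⟩
  have hφF := memLp_comp_of_lipschitzWith hn (fun j => (hx j).1) (fun j => (hy j).1) ht.1 hφ
  have key := fun k => exists_isWeakPartial_comp hΩ (fun j => (hx j).1.integrable hp)
    (fun j => (hy j).1.integrable hp) (ht.1.integrable hp) (fun j => (hα k j).integrable hp)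
    (fun j => (hβ k j).integrable hp) ((hτ k).integrable hp) (hwx k) (hwy k) (hwt k) (hc k)
    (hg.integrable hp) (fun x _ => Finset.single_le_sum
      (f := fun k => ∑ j, (|α k j x| + |β k j x|)) (fun k _ => by positivity) (Finset.mem_univ k))
    hφ (hφF.integrable hp)
  refine ⟨⟨hφF, fun k => ?_⟩, fun k => ?_⟩
  · obtain ⟨v, hvm, hw, hv⟩ := key k
    exact ⟨v, (hg.const_mul (K : ℝ)).mono' hvm hv, hw⟩
  · obtain ⟨v, -, hw, hv⟩ := key k
    exact ⟨v, hw, hv⟩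

end Heis

/-! ### Difference quotients and averages at almost every point -/

section Averages

open Filter Topology

theorem eventually_mem_segmentBase {E : Type*} [NormedAddCommGroup E] [NormedSpace ℝ E]
    {Ω : Set E} (hΩ : IsOpen Ω) {x : E} (hx : x ∈ Ω) (e : E) :
    ∀ᶠ N : ℕ in atTop, x ∈ segmentBase Ω e (1 / (N + 1)) := by
  obtain ⟨δ, hδ, h⟩ := (isCompact_singleton (x := x)).exists_forall_add_smul_mem hΩ
    (by simpa using hx) e
  filter_upwards [tendsto_one_div_add_atTop_nhds_zero_nat.eventually_lt_const hδ] with N hN r hr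
  refine h x rfl r ?_
  rw [abs_of_nonneg hr.1]
  exact hr.2.trans hN.le

variable {m : ℕ} {Ω : Set (EuclideanSpace ℝ (Fin m))} {k : Fin m}
  {u v : EuclideanSpace ℝ (Fin m) → ℝ}

theorem ae_tendsto_average_of_integrableOn (hΩ : IsOpen Ω) (hv : IntegrableOn v Ω)
    (e : EuclideanSpace ℝ (Fin m)) :
    ∀ᵐ x, x ∈ Ω → Tendsto
      (fun N : ℕ => ((N : ℝ) + 1) * ∫ r in (0 : ℝ)..1 / (N + 1), v (x + r • e)) atTop (𝓝 (v x)) := by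
  filter_upwards [ae_tendsto_average_add_smul (hv.integrable_indicator hΩ.measurableSet) e]
    with x hx hxΩ
  rw [indicator_of_mem hxΩ] at hx
  refine hx.congr' ?_
  filter_upwards [eventually_mem_segmentBase hΩ hxΩ e] with N hN
  congr 1
  refine intervalIntegral.integral_congr fun r hr => ?_
  rw [uIcc_of_le (by positivity)] at hr
  exact indicator_of_mem (hN r hr) v

/-- The weak partial derivative is the limit almost everywhere of difference quotients. -/
theorem IsWeakPartial.ae_tendsto (h : IsWeakPartial Ω k u v) (hΩ : IsOpen Ω)
    (hu : IntegrableOn u Ω) (hv : IntegrableOn v Ω) :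
    ∀ᵐ x, x ∈ Ω → Tendsto (fun N : ℕ => ((N : ℝ) + 1) *
      (u (x + (1 / ((N : ℝ) + 1)) • EuclideanSpace.single k 1) - u x)) atTop (𝓝 (v x)) := by
  have h1 : ∀ N : ℕ, ∀ᵐ x, x ∈ segmentBase Ω (EuclideanSpace.single k 1) (1 / ((N : ℝ) + 1)) →
      u (x + (1 / ((N : ℝ) + 1)) • EuclideanSpace.single k 1) - u x =
        ∫ r in (0 : ℝ)..1 / ((N : ℝ) + 1), v (x + r • EuclideanSpace.single k 1) :=
    fun N => h.ae_sub_eq_integral hΩ hu hv (by positivity)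
  filter_upwards [ae_tendsto_average_of_integrableOn hΩ hv (EuclideanSpace.single k 1),
    ae_all_iff.2 h1] with x hx hx1 hxΩ
  refine (hx hxΩ).congr' ?_
  filter_upwards [eventually_mem_segmentBase hΩ hxΩ (EuclideanSpace.single k 1)] with N hN
  rw [hx1 N hN]

theorem IsWeakPartial.ae_abs_sub_le_integral {g : EuclideanSpace ℝ (Fin m) → ℝ}
    (h : IsWeakPartial Ω k u v) (hΩ : IsOpen Ω) (hu : IntegrableOn u Ω) (hg : IntegrableOn g Ω)
    (hvg : ∀ᵐ x ∂(volume.restrict Ω), |v x| ≤ g x) {s : ℝ} (hs : 0 ≤ s) :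
    ∀ᵐ x, x ∈ segmentBase Ω (EuclideanSpace.single k 1) s →
      |u (x + s • EuclideanSpace.single k 1) - u x| ≤
        ∫ r in (0 : ℝ)..s, g (x + r • EuclideanSpace.single k 1) := by
  have hv : IntegrableOn v Ω := Integrable.mono' hg h.2.1.aestronglyMeasurable hvg
  filter_upwards [h.ae_sub_eq_integral hΩ hu hv hs,
    ae_intervalIntegrable_of_integrableOn hΩ hg (EuclideanSpace.single k 1) hs,
    ae_ae_add_smul ((ae_restrict_iff' hΩ.measurableSet).1 hvg) (EuclideanSpace.single k 1)]
    with x h1 h2 h3 hx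
  rw [h1 hx, ← Real.norm_eq_abs]
  refine intervalIntegral.norm_integral_le_of_norm_le hs ?_ (h2 hx)
  filter_upwards [h3] with r hr hm using hr (hx r (Ioc_subset_Icc_self hm))

end Averages

/-! ### Bounded Ambrosio-Reshetnyak-Sobolev maps satisfy the contact equation -/

namespace Heis

open Filter Topology

variable {n : ℕ}

theorem lipschitzWith_x (j : Fin n) : LipschitzWith 1 fun p : Heis n => p.x j := fun p q => by
  rw [edist_comm, edist_dist, Real.dist_eq, ENNReal.coe_one, one_mul]
  exact ofReal_abs_x_sub_le p q j

theorem lipschitzWith_y (j : Fin n) : LipschitzWith 1 fun p : Heis n => p.y j := fun p q => by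
  rw [edist_comm, edist_dist, Real.dist_eq, ENNReal.coe_one, one_mul]
  exact ofReal_abs_y_sub_le p q j

theorem abs_x_sub_le_toReal (hn : 1 ≤ n) (p q : Heis n) (j : Fin n) :
    |q.x j - p.x j| ≤ (ccDist p q).toReal :=
  (ENNReal.ofReal_le_iff_le_toReal (ccDist_ne_top hn p q)).1 (ofReal_abs_x_sub_le p q j)

theorem abs_y_sub_le_toReal (hn : 1 ≤ n) (p q : Heis n) (j : Fin n) :
    |q.y j - p.y j| ≤ (ccDist p q).toReal :=
  (ENNReal.ofReal_le_iff_le_toReal (ccDist_ne_top hn p q)).1 (ofReal_abs_y_sub_le p q j)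

theorem abs_heightGap_le_toReal (hn : 1 ≤ n) (p q : Heis n) :
    |heightGap p q| ≤ 4 * n * (ccDist p q).toReal ^ 2 := by
  have h1 := (ENNReal.ofReal_le_iff_le_toReal (ccDist_ne_top hn p q)).1
    (ofReal_sqrt_heightGap_le p q)
  have h2 := (Real.sqrt_le_iff.1 h1).2
  have hn' : (0 : ℝ) < n := by exact_mod_cast hn
  rwa [div_le_iff₀' (by positivity)] at h2

/-- The increment of `t` is the height gap, at most `4 n d² ≤ 4 n D d`, plus a term linear in the
increments of `x` and `y`, at most `4 n M d`. McShane extension then makes the function global.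
Boundedness of `F` matters only here: `t` is not globally Lipschitz. -/
theorem exists_lipschitzWith_eqOn_t (hn : 1 ≤ n) {S : Set (Heis n)} {M D : ℝ}
    (hx : ∀ p ∈ S, ∀ j, |p.x j| ≤ M) (hy : ∀ p ∈ S, ∀ j, |p.y j| ≤ M)
    (hD : ∀ p ∈ S, ∀ q ∈ S, (ccDist p q).toReal ≤ D) :
    ∃ (K : ℝ≥0) (φ : Heis n → ℝ), LipschitzWith K φ ∧ ∀ p ∈ S, φ p = p.t := by
  let _ : PseudoMetricSpace (Heis n) :=
    PseudoEMetricSpace.toPseudoMetricSpace fun p q => ccDist_ne_top hn p q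
  have hL : LipschitzOnWith (Real.toNNReal (4 * n * D + 4 * n * M)) (fun p : Heis n => p.t) S := by
    refine LipschitzOnWith.of_dist_le_mul fun q hq p hp => ?_
    rw [dist_comm q p]
    have hd : dist p q = (ccDist p q).toReal := rfl
    have hdD := hD p hp q hq
    have hd0 : 0 ≤ (ccDist p q).toReal := ENNReal.toReal_nonneg
    have hgap := abs_heightGap_le_toReal hn p q
    rw [Real.dist_eq, hd]
    set d := (ccDist p q).toReal with hd_def
    have hsum : |∑ j, (p.y j * (q.x j - p.x j) - p.x j * (q.y j - p.y j))| ≤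
        ∑ _j : Fin n, 2 * M * d := by
      refine (Finset.abs_sum_le_sum_abs _ _).trans (Finset.sum_le_sum fun j _ => ?_)
      refine (abs_sub _ _).trans ?_
      rw [abs_mul, abs_mul]
      have h1 := mul_le_mul (hy p hp j) (abs_x_sub_le_toReal hn p q j) (abs_nonneg _)
        ((abs_nonneg _).trans (hy p hp j))
      have h2 := mul_le_mul (hx p hp j) (abs_y_sub_le_toReal hn p q j) (abs_nonneg _)
        ((abs_nonneg _).trans (hx p hp j))
      linarith
    rw [Finset.sum_const, Finset.card_univ, Fintype.card_fin, nsmul_eq_mul] at hsum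
    have e : q.t - p.t = heightGap p q +
        2 * ∑ j, (p.y j * (q.x j - p.x j) - p.x j * (q.y j - p.y j)) := by
      rw [heightGap]
      ring
    have h3 : (n : ℝ) * (d * d) ≤ n * (D * d) := by gcongr
    calc |q.t - p.t| ≤ 4 * n * d ^ 2 + 2 * (n * (2 * M * d)) := by
          rw [e]
          refine (abs_add_le _ _).trans (add_le_add hgap ?_)
          rw [abs_mul, abs_two]
          linarith
      _ ≤ (4 * n * D + 4 * n * M) * d := by linarith
      _ ≤ _ := mul_le_mul_of_nonneg_right (Real.le_coe_toNNReal _) hd0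
  obtain ⟨φ, hφ, hφS⟩ := hL.extend_real
  exact ⟨_, φ, hφ, fun p hp => (hφS hp).symm⟩

theorem lipschitzWith_ccDist_toReal (hn : 1 ≤ n) (p : Heis n) :
    LipschitzWith 1 fun q : Heis n => (ccDist p q).toReal := by
  let _ : PseudoMetricSpace (Heis n) :=
    PseudoEMetricSpace.toPseudoMetricSpace fun p q => ccDist_ne_top hn p q
  exact LipschitzWith.dist_right p

variable {m : ℕ} {Ω : Set (EuclideanSpace ℝ (Fin m))} {k : Fin m}
  {F : EuclideanSpace ℝ (Fin m) → Heis n} {g : EuclideanSpace ℝ (Fin m) → ℝ}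

/-- The distances from the points of a countable dense set are 1-Lipschitz and share the same `g`;
their increments determine the distance, and countability keeps the union of the exceptional sets
null. -/
theorem ae_ccDist_le_integral (hn : 1 ≤ n) (hΩ : IsOpen Ω) (hg : IntegrableOn g Ω)
    (hF : ∀ φ : Heis n → ℝ, LipschitzWith 1 φ → IntegrableOn (fun x => φ (F x)) Ω ∧
      ∃ v, IsWeakPartial Ω k (fun x => φ (F x)) v ∧ ∀ᵐ x ∂(volume.restrict Ω), |v x| ≤ g x)
    {s : ℝ} (hs : 0 ≤ s) :
    ∀ᵐ x, x ∈ segmentBase Ω (EuclideanSpace.single k 1) s →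
      (ccDist (F x) (F (x + s • EuclideanSpace.single k 1))).toReal ≤
        ∫ r in (0 : ℝ)..s, g (x + r • EuclideanSpace.single k 1) := by
  have := separableSpace hn
  have : Nonempty (Heis n) := ⟨⟨0, 0, 0⟩⟩
  have h1 : ∀ i : ℕ, ∀ᵐ x, x ∈ segmentBase Ω (EuclideanSpace.single k 1) s →
      |(ccDist (TopologicalSpace.denseSeq (Heis n) i)
          (F (x + s • EuclideanSpace.single k 1))).toReal -
        (ccDist (TopologicalSpace.denseSeq (Heis n) i) (F x)).toReal| ≤
        ∫ r in (0 : ℝ)..s, g (x + r • EuclideanSpace.single k 1) := fun i => by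
    obtain ⟨hi, v, hv, hvg⟩ := hF _ (lipschitzWith_ccDist_toReal hn
      (TopologicalSpace.denseSeq (Heis n) i))
    exact hv.ae_abs_sub_le_integral hΩ hi hg hvg hs
  filter_upwards [ae_all_iff.2 h1] with x hx hm
  refine le_of_forall_pos_le_add fun ε hε => ?_
  let _ : PseudoMetricSpace (Heis n) :=
    PseudoEMetricSpace.toPseudoMetricSpace fun p q => ccDist_ne_top hn p q
  -- With `q_i` within `ε/2` of `F x`, the triangle inequality through `q_i` costs `2 d(q_i, F x) <
  -- ε` beyond the increment of `d(q_i, ·)`.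
  obtain ⟨i, hi⟩ := (TopologicalSpace.denseRange_denseSeq (Heis n)).exists_dist_lt (F x)
    (half_pos hε)
  have h2 : |dist (TopologicalSpace.denseSeq (Heis n) i) (F (x + s • EuclideanSpace.single k 1)) -
      dist (TopologicalSpace.denseSeq (Heis n) i) (F x)| ≤ _ := hx i hm
  have h3 := dist_triangle_left (F x) (F (x + s • EuclideanSpace.single k 1))
    (TopologicalSpace.denseSeq (Heis n) i)
  have h4 := (abs_le.1 h2).2
  rw [dist_comm] at hi
  have h5 : dist (F x) (F (x + s • EuclideanSpace.single k 1)) ≤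
    (∫ r in (0 : ℝ)..s, g (x + r • EuclideanSpace.single k 1)) + ε := by linarith
  exact h5

/-- The difference quotients of the height gap converge to the contact defect, while the quadratic
bound by the distance forces them to zero. -/
theorem ae_contact (hn : 1 ≤ n) (hΩ : IsOpen Ω)
    {α β : Fin n → EuclideanSpace ℝ (Fin m) → ℝ} {τ : EuclideanSpace ℝ (Fin m) → ℝ}
    (hFx : ∀ j, IntegrableOn (fun x => (F x).x j) Ω)
    (hFy : ∀ j, IntegrableOn (fun x => (F x).y j) Ω) (hFt : IntegrableOn (fun x => (F x).t) Ω)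
    (hα : ∀ j, IntegrableOn (α j) Ω) (hβ : ∀ j, IntegrableOn (β j) Ω) (hτ : IntegrableOn τ Ω)
    (hwx : ∀ j, IsWeakPartial Ω k (fun x => (F x).x j) (α j))
    (hwy : ∀ j, IsWeakPartial Ω k (fun x => (F x).y j) (β j))
    (hwt : IsWeakPartial Ω k (fun x => (F x).t) τ) (hg : IntegrableOn g Ω)
    (hd : ∀ s : ℝ, 0 ≤ s → ∀ᵐ x, x ∈ segmentBase Ω (EuclideanSpace.single k 1) s →
      (ccDist (F x) (F (x + s • EuclideanSpace.single k 1))).toReal ≤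
        ∫ r in (0 : ℝ)..s, g (x + r • EuclideanSpace.single k 1)) :
    ∀ᵐ x ∂(volume.restrict Ω), τ x = 2 * ∑ j, ((F x).y j * α j x - (F x).x j * β j x) := by
  refine (ae_restrict_iff' hΩ.measurableSet).2 ?_
  filter_upwards [ae_all_iff.2 fun j => (hwx j).ae_tendsto hΩ (hFx j) (hα j),
    ae_all_iff.2 fun j => (hwy j).ae_tendsto hΩ (hFy j) (hβ j), hwt.ae_tendsto hΩ hFt hτ,
    ae_tendsto_average_of_integrableOn hΩ hg (EuclideanSpace.single k 1),
    ae_all_iff.2 fun N : ℕ => hd (1 / ((N : ℝ) + 1)) (by positivity)] with x tα tβ tτ tg hdx hx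
  have hlim : Tendsto (fun N : ℕ => ((N : ℝ) + 1) *
      heightGap (F x) (F (x + (1 / ((N : ℝ) + 1)) • EuclideanSpace.single k 1))) atTop
      (𝓝 (τ x - 2 * ∑ j, ((F x).y j * α j x - (F x).x j * β j x))) := by
    refine ((tτ hx).sub ((tendsto_finsetSum Finset.univ fun j _ =>
      ((tα j hx).const_mul ((F x).y j)).sub ((tβ j hx).const_mul ((F x).x j))).const_mul 2)).congr
      fun N => ?_
    rw [heightGap, mul_sub ((N : ℝ) + 1) (_ - _) (2 * _), mul_left_comm ((N : ℝ) + 1) 2,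
      Finset.mul_sum Finset.univ _ ((N : ℝ) + 1)]
    congr 2
    exact Finset.sum_congr rfl fun j _ => by ring
  have hzero : Tendsto (fun N : ℕ => ((N : ℝ) + 1) *
      heightGap (F x) (F (x + (1 / ((N : ℝ) + 1)) • EuclideanSpace.single k 1))) atTop (𝓝 0) := by
    -- One factor `1/(N+1)` is left over after normalizing both integrals of `g` to averages, which
    -- converge to `g x`.
    have hb : Tendsto (fun N : ℕ => (1 / ((N : ℝ) + 1)) * (4 * n * (((N : ℝ) + 1) *
        ∫ r in (0 : ℝ)..1 / (N + 1), g (x + r • EuclideanSpace.single k 1)) ^ 2)) atTop (𝓝 0) := by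
      have := tendsto_one_div_add_atTop_nhds_zero_nat.mul (((tg hx).pow 2).const_mul (4 * (n : ℝ)))
      rwa [zero_mul] at this
    refine squeeze_zero_norm' ?_ hb
    filter_upwards [eventually_mem_segmentBase hΩ hx (EuclideanSpace.single k 1)] with N hN
    have hN0 : (0 : ℝ) < (N : ℝ) + 1 := by positivity
    rw [norm_mul, Real.norm_of_nonneg hN0.le, Real.norm_eq_abs]
    have h1 := abs_heightGap_le_toReal hn (F x)
      (F (x + (1 / ((N : ℝ) + 1)) • EuclideanSpace.single k 1))
    have h2 := pow_le_pow_left₀ ENNReal.toReal_nonneg (hdx N hN) 2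
    calc _ ≤ ((N : ℝ) + 1) * (4 * n *
          (∫ r in (0 : ℝ)..1 / (N + 1), g (x + r • EuclideanSpace.single k 1)) ^ 2) := by
          refine mul_le_mul_of_nonneg_left (h1.trans ?_) hN0.le
          exact mul_le_mul_of_nonneg_left h2 (by positivity)
      _ = _ := by field_simp
  exact sub_eq_zero.1 (tendsto_nhds_unique hlim hzero)

theorem mem_sobolevHeis_of_mem_arSobolev (hn : 1 ≤ n) (hΩ : IsOpen Ω)
    (hb : Bornology.IsBounded Ω) {p : ℝ≥0∞} (hp : 1 ≤ p)
    (hF : F ∈ (ARSobolev p Ω : Set (EuclideanSpace ℝ (Fin m) → Heis n)))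
    (hdiam : Metric.ediam (F '' Ω) < ⊤) : F ∈ SobolevHeis n p Ω := by
  have : IsFiniteMeasure (volume.restrict Ω) := ⟨by simpa using hb.measure_lt_top⟩
  obtain ⟨g, -, hg, hφ⟩ := hF
  have hx := fun j => (hφ 1 _ (lipschitzWith_x j)).1
  have hy := fun j => (hφ 1 _ (lipschitzWith_y j)).1
  have ht : (fun x => (F x).t) ∈ SobolevReal p Ω := by
    have hD : ∀ q ∈ F '' Ω, ∀ r ∈ F '' Ω,
        (ccDist q r).toReal ≤ (Metric.ediam (F '' Ω)).toReal := fun q hq r hr =>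
      ENNReal.toReal_mono hdiam.ne (Metric.edist_le_ediam_of_mem hq hr)
    obtain ⟨M, hMx, hMy⟩ : ∃ M : ℝ, (∀ q ∈ F '' Ω, ∀ j, |q.x j| ≤ M) ∧
        ∀ q ∈ F '' Ω, ∀ j, |q.y j| ≤ M := by
      -- A base point of the image is needed to turn finite diameter into coordinate bounds; with an
      -- empty image any `M` works.
      rcases (F '' Ω).eq_empty_or_nonempty with h | ⟨q₀, hq₀⟩
      · simp [h]
      refine ⟨∑ j, (|q₀.x j| + |q₀.y j|) + (Metric.ediam (F '' Ω)).toReal, fun q hq j => ?_,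
        fun q hq j => ?_⟩
      all_goals
        have h1 : |q₀.x j| + |q₀.y j| ≤ ∑ j, (|q₀.x j| + |q₀.y j|) :=
          Finset.single_le_sum (f := fun j => |q₀.x j| + |q₀.y j|) (fun _ _ => by positivity)
            (Finset.mem_univ j)
        have h2 := (abs_x_sub_le_toReal hn q₀ q j).trans (hD q₀ hq₀ q hq)
        have h3 := (abs_y_sub_le_toReal hn q₀ q j).trans (hD q₀ hq₀ q hq)
        have h4 := abs_sub_abs_le_abs_sub (q.x j) (q₀.x j)
        have h5 := abs_sub_abs_le_abs_sub (q.y j) (q₀.y j)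
        linarith [abs_nonneg (q₀.x j), abs_nonneg (q₀.y j)]
    obtain ⟨K, φ, hK, hφt⟩ := exists_lipschitzWith_eqOn_t hn hMx hMy hD
    exact SobolevReal.congr (hφ K φ hK).1 hΩ.measurableSet fun x hx => (hφt _ (mem_image_of_mem F hx)).symm
  refine ⟨hx, hy, ht, fun k => ?_⟩
  choose α hα hwx using fun j => (hx j).2 k
  choose β hβ hwy using fun j => (hy j).2 k
  obtain ⟨τ, hτ, hwt⟩ := ht.2 k
  refine ⟨α, β, τ, hwx, hwy, hwt, ae_contact hn hΩ (fun j => (hx j).1.integrable hp)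
    (fun j => (hy j).1.integrable hp) (ht.1.integrable hp) (fun j => (hα j).integrable hp)
    (fun j => (hβ j).integrable hp) (hτ.integrable hp) hwx hwy hwt (hg.integrable hp)
    fun s hs => ae_ccDist_le_integral hn hΩ (hg.integrable hp) (fun φ hL => ?_) hs⟩
  obtain ⟨h1, h2⟩ := hφ 1 φ hL
  obtain ⟨v, hv, hvg⟩ := h2 k
  exact ⟨h1.1.integrable hp, v, hv, by simpa using hvg⟩

end Heis

theorem proposition3p3 {m n : ℕ} (hn : 1 ≤ n) (Ω : Set (EuclideanSpace ℝ (Fin m)))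
    (hΩ_open : IsOpen Ω) (hΩ_conn : IsPreconnected Ω) (hΩ_bdd : Bornology.IsBounded Ω)
    (p : ℝ≥0∞) (hp_one : 1 ≤ p) (hp_top : p ≠ ⊤) :
    SobolevHeis n p Ω ⊆ (ARSobolev p Ω : Set (EuclideanSpace ℝ (Fin m) → Heis n)) ∧
    ∀ F ∈ (ARSobolev p Ω : Set (EuclideanSpace ℝ (Fin m) → Heis n)),
      Metric.ediam (F '' Ω) < ⊤ → F ∈ SobolevHeis n p Ω :=
  ⟨Heis.sobolevHeis_subset_arSobolev hn hΩ_open hΩ_bdd hp_one, fun _ hF hdiam =>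
    Heis.mem_sobolevHeis_of_mem_arSobolev hn hΩ_open hΩ_bdd hp_one hF hdiam⟩
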